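/- Let $0<\alpha<1$ and $N\ge 1$. For $a_0,a_1,a_2\in\mathbb{R}$ let $A$ be the $N\times N$ matrix, with rows and columns indexed modulo $N$, that has $a_1$ on the diagonal, $a_2$ at the entries $(k,k+1)$ and $a_0$ at the entries $(k,k-1)$, coinciding entries being added (so $A=\begin{pmatrix}a_1&a_0+a_2\\a_0+a_2&a_1\end{pmatrix}$ for $N=2$ and $A=(a_1+a_0+a_2)$ for $N=1$). Consider the linear fractional-order coupled map lattice $$X_{t+1}=X_0+\sum_{j=0}^{t}\frac{\Gamma(t-j+\alpha)}{\Gamma(\alpha)\,\Gamma(t-j+1)}\,(A-I)X_j,\qquad X_t\in\mathbb{R}^N,\ t=0,1,2,\dots$$ Take $a_0=-a_2$, and let the stable region be the set of all $(a_1,a_2)\in\mathbb{R}^2$ for which the zero solution is asymptotically stable (Lyapunov stable and attractive). For $1\le j\le\lfloor N/2\rfloor$ with $\sin(2\pi j/N)\ne 0$ let $\gamma_j$ be the closed curve ("cardioid") in the $a_1a_2$-plane $$\gamma_j(t)=\Big(\operatorname{Re}\big[e^{it}(1-e^{-it})^{\alpha}\big]+1,\ \frac{1}{2\sin(2\pi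 j/N)}\operatorname{Im}\big[e^{it}(1-e^{-it})^{\alpha}\big]\Big),\qquad 0\le t\le 2\pi,$$ with the principal branch of the power. The interior of $\gamma_j$ is the set of points off the curve whose connected component in the complement of the curve is bounded. Then: 1. The set of eigenvalues of $A$ is $\{a_1+2i\,a_2\sin(2\pi j/N): j=0,\dots,N-1\}$. 2. If $N=1$ or $N=2$, the stable region is $\{(a_1,a_2): 1-2^{\alpha}<a_1<1\}$. 3. If $N\ge 3$ is odd, put $j=\lceil (N-1)/4\rceil$; if $N\ge 4$ is even, put $j=\lfloor N/4\rfloor$. In both cases the stable region is the region bounded by the line $a_1=1$ and the cardioid $\gamma_j$, that is, the set of points $(a_1,a_2)$ in the interior of $\gamma_j$ with $a_1<1$. Moreover $1\le j\le\lfloor N/2\rfloor$, $\sin(2\pi j/N)\neq 0$, and $\gamma_j$ is the innermost cardioid: for every $1\le k\le\lfloor N/2\rfloor$ with $\sin(2\pi k/N)\ne 0$, the part of the interior of $\gamma_j$ with $a_1<1$ is contained in the interior of $\gamma_k$. -/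

import Mathlib

noncomputable section

namespace FracCML

/-- The `N × N` connectivity matrix of the one-dimensional lattice with periodic boundary
conditions, sites being indexed modulo `N`: `a₁` on the diagonal, `a₂` towards the right
neighbour, `a₀` towards the left neighbour. Coinciding neighbours add up, so that it is
`!![a₁, a₀ + a₂; a₀ + a₂, a₁]` for `N = 2` and `!![a₁ + a₀ + a₂]` for `N = 1`. -/
def couplingMatrix (N : ℕ) (a₀ a₁ a₂ : ℝ) : Matrix (ZMod N) (ZMod N) ℝ :=
  Matrix.of fun k m =>
    (if m = k then a₁ else 0) + (if m = k + 1 then a₂ else 0) + (if m = k - 1 then a₀ else 0)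

/-- `X` solves the linear fractional-order coupled map lattice
`X_{t+1} = X_0 + ∑_{j=0}^{t} Γ(t-j+α) / (Γ(α) Γ(t-j+1)) (A - I) X_j`. -/
def IsSolution {ι : Type*} [Fintype ι] [DecidableEq ι] (α : ℝ) (A : Matrix ι ι ℝ)
    (X : ℕ → ι → ℝ) : Prop :=
  ∀ t : ℕ, X (t + 1) = X 0 + ∑ j ∈ Finset.range (t + 1),
    (Real.Gamma ((t : ℝ) - j + α) / (Real.Gamma α * Real.Gamma ((t : ℝ) - j + 1))) •
      Matrix.mulVec (A - 1) (X j)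

/-- The zero solution is asymptotically stable: Lyapunov stable and attractive. -/
def AsymptoticallyStable {ι : Type*} [Fintype ι] [DecidableEq ι] (α : ℝ)
    (A : Matrix ι ι ℝ) : Prop :=
  (∀ ε > 0, ∃ δ > 0, ∀ X : ℕ → ι → ℝ, IsSolution α A X → ‖X 0‖ < δ → ∀ t, ‖X t‖ < ε) ∧
  (∃ η > 0, ∀ X : ℕ → ι → ℝ, IsSolution α A X → ‖X 0‖ < η →
    Filter.Tendsto X Filter.atTop (nhds 0))

/-- The stable region, in the `a₁a₂`-plane, of the system with `a₀ = -a₂`. -/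
def stableRegion (α : ℝ) (N : ℕ) [NeZero N] : Set (ℝ × ℝ) :=
  {p | AsymptoticallyStable α (couplingMatrix N (-p.2) p.1 p.2)}

/-- The parametrised cardioid `γ_j` in the `a₁a₂`-plane (meaningful if `sin (2πj/N) ≠ 0`). -/
def cardioid (α : ℝ) (N j : ℕ) (t : ℝ) : ℝ × ℝ :=
  let c : ℂ := Complex.exp (Complex.I * t) * (1 - Complex.exp (-(Complex.I * t))) ^ (α : ℂ)
  (c.re + 1, 1 / (2 * Real.sin (2 * Real.pi * j / N)) * c.im)

/-- The points enclosed by a plane curve `C`: those off `C` whose connected component in the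
complement of `C` is bounded. -/
def inside (C : Set (ℝ × ℝ)) : Set (ℝ × ℝ) :=
  {p | p ∉ C ∧ Bornology.IsBounded (connectedComponentIn Cᶜ p)}

/-- The open region enclosed by the cardioid `γ_j`, parametrised by `0 ≤ t ≤ 2π`. -/
def cardioidInterior (α : ℝ) (N j : ℕ) : Set (ℝ × ℝ) :=
  inside (cardioid α N j '' Set.Icc 0 (2 * Real.pi))

/-- Among the cardioids `γ_k`, `1 ≤ k ≤ ⌊N/2⌋`, `sin (2πk/N) ≠ 0`, the cardioid `γ_j` is the
innermost one to the left of the line `a₁ = 1`. -/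
def IsInnermost (α : ℝ) (N j : ℕ) : Prop :=
  (1 ≤ j ∧ j ≤ N / 2 ∧ Real.sin (2 * Real.pi * j / N) ≠ 0) ∧
  ∀ k : ℕ, 1 ≤ k → k ≤ N / 2 → Real.sin (2 * Real.pi * k / N) ≠ 0 →
    cardioidInterior α N j ∩ {p | p.1 < 1} ⊆ cardioidInterior α N k

end FracCML

end

/-!
Put `μ = λ - 1` for an eigenvalue `λ` of `A`. The coupling matrix with `a₀ = -a₂` is diagonalized
by the characters of `ℤ / N`, with eigenvalues `a₁ + 2 i a₂ sin (2πj/N)`, so the system splits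
into scalar equations `x_{t+1} = x_0 + μ ∑ b_{t-j} x_j`, where `b_n` is the coefficient of `zⁿ` in
`(1 - z)^(-α)`; it is asymptotically stable exactly when all these scalar solutions tend to zero
(`asymptoticallyStable_iff`).

The generating function of the scalar solution is `(1 - z)^(α-1) / ((1 - z)^α - z μ)`. If the
characteristic equation `(1 - z)^α = z μ` has no root in the closed unit disk, this function is
integrable on the unit circle, so its coefficients are Fourier coefficients of an integrable
function and tend to zero by the Riemann-Lebesgue lemma (`tendsto_coeff_zero`). A root in the
closed disk other than `1` is a pole, which is impossible for a power series whose coefficients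
tend to zero; a root at `1` means `μ = 0` and a constant solution (`tendsto_scalarSol_iff`).

The roots on the unit circle correspond to the values of `μ` on the cardioid `e^{it} (1 -
e^{-it})^α`. In polar coordinates centred at `0`, with angles `φ` measured from the negative real
axis, it is the graph of `(2 cos (φ / (2 - α)))^α`; hence it is star-shaped, and it separates the
plane into two connected open sides. Since `z ↦ (1 - z)^α / z` is a local homeomorphism of the
punctured open disk, the set of `μ` without a root in the closed disk is open and closed off the
cardioid, and looking at one point of each side identifies it with the bounded side
(`compl_rootSet`). An affine change of coordinates turns this into the interior of `γ_j`
(`cardioidInterior_eq`).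

For `Re μ < 0` the vertical sections of the bounded side are symmetric intervals
(`mem_innerRegion_of_abs_im_le`). Hence, for `a₁ < 1`, the condition on the eigenvalue with the
largest `|sin (2πj/N)|` implies all the others, while the real eigenvalue `a₁` forces `a₁ < 1`.
The largest sine belongs to the index minimizing `|4j - N|` (`stableRegion_eq`).
-/

namespace FracCML
open Filter Topology

/-! ### The scalar recursion and its generating function -/

/-- The coefficient `Γ(n+α) / (Γ(α) Γ(n+1))` of `zⁿ` in `(1 - z)^(-α)`. -/
noncomputable def kernelCoeff (α : ℝ) (n : ℕ) : ℝ :=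
  Real.Gamma (n + α) / (Real.Gamma α * Real.Gamma (n + 1))

/-- The solution with initial value `1` of the scalar equation in which `A - I` is replaced
by the complex number `μ`. -/
noncomputable def scalarSol (α : ℝ) (μ : ℂ) : ℕ → ℂ
  | 0 => 1
  | t + 1 => 1 + μ * ∑ j : Fin (t + 1), (kernelCoeff α (t - j) : ℂ) * scalarSol α μ j

theorem scalarSol_zero (α : ℝ) (μ : ℂ) : scalarSol α μ 0 = 1 := by
  rw [scalarSol]

theorem scalarSol_succ (α : ℝ) (μ : ℂ) (t : ℕ) :
    scalarSol α μ (t + 1) =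
      1 + μ * ∑ j ∈ Finset.range (t + 1), (kernelCoeff α (t - j) : ℂ) * scalarSol α μ j := by
  rw [scalarSol, Finset.sum_range]

theorem eq_mul_scalarSol {α : ℝ} {μ : ℂ} {c : ℕ → ℂ}
    (h : ∀ t, c (t + 1) =
      c 0 + μ * ∑ j ∈ Finset.range (t + 1), (kernelCoeff α (t - j) : ℂ) * c j) (t : ℕ) :
    c t = c 0 * scalarSol α μ t := by
  induction t using Nat.strong_induction_on with
  | _ t ih =>
    cases t with
    | zero => rw [scalarSol_zero, mul_one]
    | succ t =>
      rw [h, scalarSol_succ, mul_add, mul_one, mul_left_comm, Finset.mul_sum (a := c 0)]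
      congr 2
      refine Finset.sum_congr rfl fun j hj => ?_
      rw [ih j (Finset.mem_range.1 hj)]
      ring

theorem kernelCoeff_eq_choose {α : ℝ} (hα : 0 < α) (n : ℕ) :
    (kernelCoeff α n : ℂ) = Ring.choose ((α : ℂ) + n - 1) n := by
  rw [← Ring.multichoose_eq]
  have h := Ring.factorial_nsmul_multichoose_eq_ascPochhammer (α : ℂ) n
  have hP : (ascPochhammer ℕ n).smeval (α : ℂ) =
      ((Real.Gamma (n + α) / Real.Gamma α : ℝ) : ℂ) := by
    clear h
    induction n with
    | zero => simp [(Real.Gamma_pos_of_pos hα).ne']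
    | succ n ih =>
      rw [ascPochhammer_succ_right, Polynomial.smeval_mul, ih]
      have h1 : Real.Gamma ((n + 1 : ℕ) + α) = (n + α) * Real.Gamma (n + α) := by
        rw [← Real.Gamma_add_one (by positivity)]
        push_cast
        ring_nf
      rw [h1]
      simp [Polynomial.smeval_add, Polynomial.smeval_natCast]
      ring
  rw [hP, nsmul_eq_mul] at h
  have hn : (n.factorial : ℂ) ≠ 0 := by exact_mod_cast n.factorial_ne_zero
  rw [kernelCoeff, Real.Gamma_nat_eq_factorial]
  apply mul_left_cancel₀ hn
  rw [h]
  push_cast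
  field_simp

theorem hasSum_kernelCoeff {α : ℝ} (hα : 0 < α) {z : ℂ} (hz : ‖z‖ < 1) :
    HasSum (fun n => (kernelCoeff α n : ℂ) * z ^ n) (((1 - z) ^ (α : ℂ))⁻¹) := by
  have h := (Complex.one_div_one_sub_cpow_hasFPowerSeriesOnBall_zero (α : ℂ)).hasSum
    (y := z) (by
      rw [← ENNReal.ofReal_one, Metric.eball_ofReal]
      simpa using hz)
  simp only [zero_add, one_div] at h
  convert! h using 2 with n
  rw [kernelCoeff_eq_choose hα]
  simp [mul_comm]

/-- One step of the scalar recursion, seen on generating functions. -/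
theorem hasSum_recursion {α : ℝ} (hα : 0 < α) (μ : ℂ) {z : ℂ} (hz : ‖z‖ < 1) {c c' : ℕ → ℂ}
    (h0 : c' 0 = 1)
    (h : ∀ t, c' (t + 1) = 1 + μ * ∑ j ∈ Finset.range (t + 1), (kernelCoeff α (t - j) : ℂ) * c j)
    {s : ℂ} (hs : HasSum (fun n => c n * z ^ n) s) :
    HasSum (fun n => c' n * z ^ n) ((1 - z)⁻¹ + z * μ * ((1 - z) ^ (α : ℂ))⁻¹ * s) := by
  have hk := hasSum_kernelCoeff hα hz
  have hp := hasSum_sum_range_mul_of_summable_norm hs.summable.norm hk.summable.norm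
  rw [hs.tsum_eq, hk.tsum_eq] at hp
  have hg := hasSum_geometric_of_norm_lt_one hz
  have hg' : HasSum (fun n => z ^ (n + 1)) ((1 - z)⁻¹ - 1) := by
    rw [hasSum_nat_add_iff' (f := fun n => z ^ n) 1 |>.symm] at hg
    simpa using hg
  rw [← hasSum_nat_add_iff' 1]
  convert! hg'.add (hp.mul_left (z * μ)) using 1
  · funext n
    rw [h, add_mul, one_mul]
    congr 1
    rw [Finset.mul_sum, Finset.sum_mul, Finset.mul_sum]
    refine Finset.sum_congr rfl fun j hj => ?_
    have hj' : j ≤ n := Nat.lt_succ_iff.1 (Finset.mem_range.1 hj)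
    rw [show z ^ (n + 1) = z * z ^ j * z ^ (n - j) by
      rw [mul_assoc, ← pow_add, Nat.add_sub_cancel' hj', pow_succ']]
    ring
  · rw [Finset.sum_range_one, h0]
    ring

theorem hasFPowerSeriesAt_of_hasSum {c : ℕ → ℂ} {f : ℂ → ℂ}
    (hc : ∀ z : ℂ, ‖z‖ < 1 → HasSum (fun n => c n * z ^ n) (f z)) :
    HasFPowerSeriesAt f (FormalMultilinearSeries.ofScalars ℂ c) 0 := by
  rw [hasFPowerSeriesAt_iff]
  filter_upwards [Metric.ball_mem_nhds (0 : ℂ) one_pos] with z hz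
  simpa [mul_comm] using hc z (by simpa using hz)

theorem coeff_unique {c d : ℕ → ℂ} {f : ℂ → ℂ}
    (hc : ∀ z : ℂ, ‖z‖ < 1 → HasSum (fun n => c n * z ^ n) (f z))
    (hd : ∀ z : ℂ, ‖z‖ < 1 → HasSum (fun n => d n * z ^ n) (f z)) : c = d := by
  have := (hasFPowerSeriesAt_of_hasSum hc).eq_formalMultilinearSeries
    (hasFPowerSeriesAt_of_hasSum hd)
  ext n
  have := congrArg (fun p => p.coeff n) this
  simpa using this

/-! ### Power series dominated on the unit circle by an integrable power -/

theorem sin_half_le_norm_one_sub_circleMap {r θ : ℝ} (hr : 1 / 4 ≤ r) :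
    Real.sin (θ / 2) ≤ ‖1 - circleMap 0 r θ‖ := by
  refine Real.le_sqrt_of_sq_le ?_ |>.trans_eq (Complex.norm_def _).symm
  have h1 : Real.cos θ = 1 - 2 * Real.sin (θ / 2) ^ 2 := by
    have := Real.cos_two_mul (θ / 2)
    rw [mul_div_cancel₀ _ (two_ne_zero)] at this
    rw [this, Real.cos_sq']
    ring
  have h2 := Real.sin_sq_add_cos_sq θ
  have h3 : Complex.normSq (1 - circleMap 0 r θ) = (1 - r) ^ 2 + 4 * r * Real.sin (θ / 2) ^ 2 := by
    rw [Complex.normSq_apply]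
    simp only [circleMap, zero_add, Complex.sub_re, Complex.one_re, Complex.sub_im, Complex.one_im,
      Complex.re_ofReal_mul, Complex.im_ofReal_mul, Complex.exp_ofReal_mul_I_re,
      Complex.exp_ofReal_mul_I_im]
    linear_combination r ^ 2 * h2 - 2 * r * h1
  rw [h3]
  nlinarith [sq_nonneg (1 - r), sq_nonneg (Real.sin (θ / 2))]

theorem sin_half_pos {θ : ℝ} (h0 : 0 < θ) (h1 : θ < 2 * Real.pi) : 0 < Real.sin (θ / 2) :=
  Real.sin_pos_of_pos_of_lt_pi (by linarith) (by linarith)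

/-- The majorant of `sin (θ / 2) ^ β` on `(0, 2π)` given by Jordan's inequality at both ends. -/
theorem sin_half_rpow_le {β θ : ℝ} (hβ : β ≤ 0) (h0 : 0 < θ) (h1 : θ < 2 * Real.pi) :
    Real.sin (θ / 2) ^ β ≤ (θ / Real.pi) ^ β + ((2 * Real.pi - θ) / Real.pi) ^ β := by
  have hpi := Real.pi_pos
  have hp1 : 0 < θ / Real.pi := by positivity
  have hp2 : 0 < (2 * Real.pi - θ) / Real.pi := div_pos (by linarith) hpi
  rcases le_total θ Real.pi with h | h
  · have := Real.mul_le_sin (x := θ / 2) (by linarith) (by linarith)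
    rw [show 2 / Real.pi * (θ / 2) = θ / Real.pi by ring] at this
    exact (Real.rpow_le_rpow_of_nonpos hp1 this hβ).trans
      (le_add_of_nonneg_right (Real.rpow_nonneg hp2.le _))
  · have := Real.mul_le_sin (x := Real.pi - θ / 2) (by linarith) (by linarith)
    rw [Real.sin_pi_sub,
      show 2 / Real.pi * (Real.pi - θ / 2) = (2 * Real.pi - θ) / Real.pi by ring] at this
    exact (Real.rpow_le_rpow_of_nonpos hp2 this hβ).trans
      (le_add_of_nonneg_left (Real.rpow_nonneg hp1.le _))

theorem intervalIntegrable_majorant {β : ℝ} (hβ : -1 < β) :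
    IntervalIntegrable (fun θ : ℝ => (θ / Real.pi) ^ β + ((2 * Real.pi - θ) / Real.pi) ^ β)
      MeasureTheory.volume 0 (2 * Real.pi) := by
  have h : ∀ a b : ℝ, IntervalIntegrable (fun θ : ℝ => (θ / Real.pi) ^ β)
      MeasureTheory.volume a b := fun a b => by
    have := (intervalIntegral.intervalIntegrable_rpow' (a := a / Real.pi) (b := b / Real.pi)
      hβ).comp_mul_right (c := Real.pi⁻¹)
    simpa [div_eq_mul_inv, Real.pi_ne_zero] using this
  refine (h _ _).add ?_
  simpa using (h (2 * Real.pi) 0).comp_sub_left (2 * Real.pi)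

/-- Cauchy's formula for the Taylor coefficients, written as a Fourier coefficient. -/
theorem coeff_mul_pow_eq_integral {G : ℂ → ℂ} {c : ℕ → ℂ}
    (hc : ∀ z : ℂ, ‖z‖ < 1 → HasSum (fun n => c n * z ^ n) (G z))
    (hG : DifferentiableOn ℂ G (Metric.ball 0 1)) {r : ℝ} (hr0 : 0 < r) (hr1 : r < 1) (n : ℕ) :
    c n * (r : ℂ) ^ n = (2 * Real.pi : ℂ)⁻¹ * ∫ θ in (0 : ℝ)..2 * Real.pi,
      Complex.exp (-(n * θ * Complex.I)) * G (circleMap 0 r θ) := by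
  lift r to NNReal using hr0.le
  have h1 : HasFPowerSeriesOnBall G (cauchyPowerSeries G 0 r) 0 r :=
    DifferentiableOn.hasFPowerSeriesOnBall
      (hG.mono (Metric.closedBall_subset_ball hr1)) (by exact_mod_cast hr0)
  have h2 := (hasFPowerSeriesAt_of_hasSum hc).eq_formalMultilinearSeries h1.hasFPowerSeriesAt
  have h3 := congrArg (fun p => p n fun _ => (r : ℂ)) h2
  simp only [cauchyPowerSeries_apply] at h3
  rw [FormalMultilinearSeries.ofScalars_apply_eq, smul_eq_mul, circleIntegral] at h3
  rw [h3, smul_eq_mul, mul_inv (2 * (Real.pi : ℂ)) Complex.I, mul_assoc,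
    ← intervalIntegral.integral_const_mul]
  congr 2
  funext θ
  have hr : (r : ℂ) ≠ 0 := by exact_mod_cast hr0.ne'
  have he := Complex.exp_ne_zero (θ * Complex.I)
  simp only [deriv_circleMap, smul_eq_mul, sub_zero, Complex.exp_neg]
  have hexp : Complex.exp (n * θ * Complex.I) = Complex.exp (θ * Complex.I) ^ n := by
    rw [← Complex.exp_nat_mul, mul_assoc]
  rw [hexp]
  generalize hg : G (circleMap 0 r θ) = g
  simp only [circleMap, zero_add]
  generalize Complex.exp (θ * Complex.I) = e at he
  field_simp
  rw [div_pow, one_pow]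
  field_simp

/-- If the power series `∑ c n * z ^ n` converges on the unit disk to a function that extends
continuously to the closed disk without `1` and is dominated by `‖1 - z‖ ^ β`, `β > -1`, then its
coefficients are Fourier coefficients of an integrable function and tend to `0`. -/
theorem tendsto_coeff_zero {G : ℂ → ℂ} {c : ℕ → ℂ} {K β : ℝ}
    (hc : ∀ z : ℂ, ‖z‖ < 1 → HasSum (fun n => c n * z ^ n) (G z))
    (hG : DifferentiableOn ℂ G (Metric.ball 0 1))
    (hcont : ContinuousOn G (Metric.closedBall 0 1 \ {1}))
    (hK : ∀ z : ℂ, ‖z‖ ≤ 1 → z ≠ 1 → ‖G z‖ ≤ K * ‖1 - z‖ ^ β) (hβ : -1 < β) (hβ0 : β ≤ 0) :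
    Tendsto c atTop (𝓝 0) := by
  have hK0 : 0 ≤ K := by simpa using (norm_nonneg _).trans (hK 0 (by simp) (by simp))
  have hne : ∀ {r θ : ℝ}, 1 / 4 ≤ r → 0 < θ → θ < 2 * Real.pi → circleMap 0 r θ ≠ 1 := by
    intro r θ hr h0 h1 h
    have := sin_half_le_norm_one_sub_circleMap (θ := θ) hr
    rw [h, sub_self, norm_zero] at this
    exact absurd (sin_half_pos h0 h1) (not_lt.2 this)
  have hmap : ∀ {r θ : ℝ}, 0 ≤ r → r ≤ 1 → ‖circleMap 0 r θ‖ ≤ 1 := by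
    intro r θ h0 h1
    simpa [abs_of_nonneg h0] using h1
  have hev : ∀ᶠ r : ℝ in 𝓝[<] 1, 1 / 4 ≤ r ∧ r < 1 := by
    filter_upwards [Ioo_mem_nhdsLT (show (1 / 4 : ℝ) < 1 by norm_num)] with r hr
    exact ⟨hr.1.le, hr.2⟩
  have hae : ∀ᵐ θ : ℝ, θ ≠ 2 * Real.pi := by
    simp [MeasureTheory.ae_iff]
  have hlim : ∀ n : ℕ, c n = (2 * Real.pi : ℂ)⁻¹ * ∫ θ in (0 : ℝ)..2 * Real.pi,
      Complex.exp (-(n * θ * Complex.I)) * G (circleMap 0 1 θ) := by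
    intro n
    have hl : Tendsto (fun r : ℝ => c n * (r : ℂ) ^ n) (𝓝[<] 1) (𝓝 (c n)) := by
      have : Continuous fun r : ℝ => c n * (r : ℂ) ^ n := by fun_prop
      simpa using (this.tendsto 1).mono_left nhdsWithin_le_nhds
    refine tendsto_nhds_unique hl ?_
    have hr : Tendsto (fun r : ℝ => (2 * Real.pi : ℂ)⁻¹ * ∫ θ in (0 : ℝ)..2 * Real.pi,
        Complex.exp (-(n * θ * Complex.I)) * G (circleMap 0 r θ)) (𝓝[<] 1)
        (𝓝 ((2 * Real.pi : ℂ)⁻¹ * ∫ θ in (0 : ℝ)..2 * Real.pi,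
          Complex.exp (-(n * θ * Complex.I)) * G (circleMap 0 1 θ))) := by
      refine Tendsto.const_mul _ ?_
      refine intervalIntegral.tendsto_integral_filter_of_dominated_convergence
        (fun θ => K * ((θ / Real.pi) ^ β + ((2 * Real.pi - θ) / Real.pi) ^ β)) ?_ ?_
        ((intervalIntegrable_majorant hβ).const_mul K) ?_
      · filter_upwards [hev] with r hr
        refine Continuous.aestronglyMeasurable ?_
        refine Continuous.mul (by fun_prop) (hcont.comp_continuous (continuous_circleMap 0 r) ?_)
        intro θ
        have : ‖circleMap 0 r θ‖ < 1 := by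
          rw [norm_circleMap_zero, abs_of_nonneg (by linarith)]
          exact hr.2
        refine ⟨by simpa using this.le, fun h => ?_⟩
        rw [Set.mem_singleton_iff.1 h, norm_one] at this
        exact lt_irrefl _ this
      · filter_upwards [hev] with r hr
        filter_upwards [hae] with θ hθ hθ'
        rw [Set.uIoc_of_le Real.two_pi_pos.le] at hθ'
        have h1 : θ < 2 * Real.pi := lt_of_le_of_ne hθ'.2 hθ
        rw [norm_mul, show ‖Complex.exp (-(n * θ * Complex.I))‖ = 1 by
          rw [Complex.norm_exp]; simp, one_mul]
        refine (hK _ (hmap (by linarith) hr.2.le) (hne hr.1 hθ'.1 h1)).trans ?_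
        refine mul_le_mul_of_nonneg_left ?_ hK0
        exact (Real.rpow_le_rpow_of_nonpos (sin_half_pos hθ'.1 h1)
          (sin_half_le_norm_one_sub_circleMap hr.1) hβ0).trans (sin_half_rpow_le hβ0 hθ'.1 h1)
      · filter_upwards [hae] with θ hθ hθ'
        rw [Set.uIoc_of_le Real.two_pi_pos.le] at hθ'
        have h1 : θ < 2 * Real.pi := lt_of_le_of_ne hθ'.2 hθ
        refine Tendsto.const_mul _ ?_
        have hc1 : ContinuousWithinAt G (Metric.closedBall 0 1 \ {1}) (circleMap 0 1 θ) :=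
          hcont _ ⟨by simp, hne (by norm_num) hθ'.1 h1⟩
        refine hc1.tendsto.comp (tendsto_nhdsWithin_iff.2 ⟨?_, ?_⟩)
        · have : Continuous fun r : ℝ => circleMap 0 r θ := by
            unfold circleMap
            fun_prop
          exact (this.tendsto 1).mono_left nhdsWithin_le_nhds
        · filter_upwards [hev] with r hr
          refine ⟨?_, hne hr.1 hθ'.1 h1⟩
          simpa using hmap (θ := θ) (by linarith [hr.1]) hr.2.le
    refine hr.congr' ?_
    filter_upwards [hev] with r hr
    exact (coeff_mul_pow_eq_integral hc hG (by linarith) hr.2 n).symm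
  have hRL := (Real.tendsto_integral_exp_smul_cocompact
    ((Set.Ioc 0 (2 * Real.pi)).indicator fun θ : ℝ => G (circleMap 0 1 θ))).comp
    ((tendsto_natCast_atTop_atTop (R := ℝ)).atTop_div_const Real.two_pi_pos
      |>.mono_right atTop_le_cocompact)
  have h := hRL.const_mul ((2 * Real.pi : ℂ)⁻¹)
  rw [mul_zero] at h
  refine h.congr fun n => ?_
  rw [hlim n, intervalIntegral.integral_of_le Real.two_pi_pos.le,
    ← MeasureTheory.integral_indicator measurableSet_Ioc, Function.comp_apply]
  congr 2
  funext θ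
  by_cases hθ : θ ∈ Set.Ioc 0 (2 * Real.pi)
  · simp only [Set.indicator_of_mem hθ, Circle.smul_def, Real.fourierChar_apply, smul_eq_mul]
    congr 2
    push_cast
    field_simp
  · simp [Set.indicator_of_notMem hθ]

/-! ### Stability of the scalar equation and the characteristic roots -/

/-- The multipliers `μ` for which the characteristic equation `(1 - z) ^ α = z μ` has a root in
the closed unit disk. -/
def rootSet (α : ℝ) : Set ℂ := {μ | ∃ z : ℂ, ‖z‖ ≤ 1 ∧ (1 - z) ^ (α : ℂ) = z * μ}

theorem re_one_sub_nonneg {z : ℂ} (hz : ‖z‖ ≤ 1) : 0 ≤ (1 - z).re := by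
  have := (Complex.re_le_norm z).trans hz
  simpa using this

theorem one_sub_mem_slitPlane {z : ℂ} (hz : ‖z‖ ≤ 1) (h1 : z ≠ 1) : 1 - z ∈ Complex.slitPlane := by
  rw [Complex.mem_slitPlane_iff]
  by_contra! h
  have h0 := re_one_sub_nonneg hz
  apply h1
  rw [← sub_eq_zero, ← neg_eq_zero, neg_sub]
  exact Complex.ext (le_antisymm h.1 h0) h.2

theorem continuousAt_one_sub_cpow {α : ℝ} (hα : 0 < α) {z : ℂ} (hz : ‖z‖ ≤ 1) :
    ContinuousAt (fun z : ℂ => (1 - z) ^ (α : ℂ)) z :=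
  (Complex.continuousAt_cpow_const_of_re_pos (z := 1 - z) (w := α)
    (Or.inl (re_one_sub_nonneg hz)) (by simpa using hα)).comp (by fun_prop)

/-- The generating function has no pole in the closed disk; its only singularity there is the
integrable one of `(1 - z) ^ (α - 1)` at `z = 1`. -/
theorem tendsto_scalarSol {α : ℝ} (hα₀ : 0 < α) (hα₁ : α < 1) {μ : ℂ} (hμ : μ ∉ rootSet α) :
    Tendsto (scalarSol α μ) atTop (𝓝 0) := by
  have hne : ∀ z : ℂ, ‖z‖ ≤ 1 → (1 - z) ^ (α : ℂ) - z * μ ≠ 0 := fun z hz h =>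
    hμ ⟨z, hz, sub_eq_zero.1 h⟩
  have hφ : ContinuousOn (fun z : ℂ => (1 - z) ^ (α : ℂ) - z * μ) (Metric.closedBall 0 1) :=
    fun z hz => ((continuousAt_one_sub_cpow hα₀ (by simpa using hz)).sub
      (by fun_prop)).continuousWithinAt
  set G : ℂ → ℂ := fun z => (1 - z) ^ ((α : ℂ) - 1) / ((1 - z) ^ (α : ℂ) - z * μ) with hGdef
  have hd1 : ∀ z : ℂ, ‖z‖ ≤ 1 → z ≠ 1 → ∀ a : ℂ, DifferentiableAt ℂ (fun z : ℂ => (1 - z) ^ a) z :=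
    fun z hz h1 a => DifferentiableAt.cpow_const (by fun_prop) (one_sub_mem_slitPlane hz h1)
  have hd : ∀ z : ℂ, ‖z‖ ≤ 1 → z ≠ 1 → DifferentiableAt ℂ G z := fun z hz h1 =>
    (hd1 z hz h1 _).div ((hd1 z hz h1 _).sub (by fun_prop)) (hne z hz)
  have hlt : ∀ z : ℂ, ‖z‖ < 1 → z ≠ 1 := by
    rintro z hz rfl
    simp at hz
  have hdG : DifferentiableOn ℂ G (Metric.ball 0 1) := fun z hz => by
    have hz : ‖z‖ < 1 := by simpa using hz
    exact (hd z hz.le (hlt z hz)).differentiableWithinAt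
  -- The Taylor coefficients of `G` satisfy the recursion, so they are the scalar solution.
  set g : ℕ → ℂ := fun n => (n.factorial : ℂ)⁻¹ * iteratedDeriv n G 0
  have hg : ∀ z : ℂ, ‖z‖ < 1 → HasSum (fun n => g n * z ^ n) (G z) := by
    intro z hz
    have := Complex.hasSum_taylorSeries_on_ball hdG (z := z) (by simpa using hz)
    convert! this using 2 with n
    simp only [g, smul_eq_mul, sub_zero]
    ring
  set g' : ℕ → ℂ := fun n => Nat.casesOn n 1 fun t =>
    1 + μ * ∑ j ∈ Finset.range (t + 1), (kernelCoeff α (t - j) : ℂ) * g j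
  have hgg : g' = g := by
    refine coeff_unique (f := G) (fun z hz => ?_) hg
    have h := hasSum_recursion hα₀ μ hz (c' := g') rfl (fun t => rfl) (hg z hz)
    convert! h using 1
    have h1 : 1 - z ≠ 0 := sub_ne_zero.2 (hlt z hz).symm
    have h2 : (1 - z) ^ (α : ℂ) ≠ 0 := by simp [Complex.cpow_eq_zero_iff, h1]
    have h3 := hne z hz.le
    simp only [hGdef]
    rw [Complex.cpow_sub _ _ h1, Complex.cpow_one]
    field_simp
    ring
  have hg0 : g 0 = 1 := (congrFun hgg 0).symm
  have hsol : scalarSol α μ = g := by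
    funext t
    rw [eq_mul_scalarSol (α := α) (μ := μ) (c := g) _ t, hg0, one_mul]
    intro t
    rw [hg0]
    exact (congrFun hgg (t + 1)).symm
  rw [hsol]
  obtain ⟨z₀, hz₀, hmin⟩ := (isCompact_closedBall (0 : ℂ) 1).exists_isMinOn
    ⟨0, by simp⟩ hφ.norm
  have hm : 0 < ‖(1 - z₀) ^ (α : ℂ) - z₀ * μ‖ := norm_pos_iff.2 (hne z₀ (by simpa using hz₀))
  refine tendsto_coeff_zero (K := ‖(1 - z₀) ^ (α : ℂ) - z₀ * μ‖⁻¹) (β := α - 1) hg hdG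
    (fun z hz => (hd z (by simpa using hz.1) hz.2).continuousAt.continuousWithinAt) ?_
    (by linarith) (by linarith)
  intro z hz _
  have h1 : ‖(1 - z) ^ ((α : ℂ) - 1)‖ = ‖1 - z‖ ^ (α - 1) := by
    rw [← Complex.norm_cpow_real]
    push_cast
    rfl
  rw [hGdef, norm_div, h1, div_eq_inv_mul]
  have h2 := isMinOn_iff.1 hmin z (by simpa using hz)
  gcongr

/-- Abel means: a null sequence satisfies `(1 - r) ∑ ‖u n‖ r ^ n → 0` as `r → 1⁻`. -/
theorem tendsto_one_sub_mul_tsum {u : ℕ → ℝ} (hu0 : ∀ n, 0 ≤ u n) (hu : Tendsto u atTop (𝓝 0)) :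
    Tendsto (fun r : ℝ => (1 - r) * ∑' n, u n * r ^ n) (𝓝[<] 1) (𝓝 0) := by
  obtain ⟨B, hB⟩ := hu.bddAbove_range
  have hB : ∀ n, u n ≤ B := fun n => hB ⟨n, rfl⟩
  have hsum : ∀ r : ℝ, 0 < r → r < 1 → Summable fun n => u n * r ^ n := fun r h0 h1 =>
    Summable.of_nonneg_of_le (fun n => mul_nonneg (hu0 n) (by positivity))
      (fun n => mul_le_mul_of_nonneg_right (hB n) (by positivity))
      ((summable_geometric_of_lt_one h0.le h1).mul_left B)
  have hev : ∀ᶠ r : ℝ in 𝓝[<] 1, 0 < r ∧ r < 1 := by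
    filter_upwards [Ioo_mem_nhdsLT (show (0 : ℝ) < 1 by norm_num)] with r hr using hr
  rw [Metric.tendsto_nhds]
  intro ε hε
  obtain ⟨n₀, hn₀⟩ := eventually_atTop.1 (hu.eventually_lt_const (half_pos hε))
  have hlim : Tendsto (fun r : ℝ => (1 - r) * ∑ n ∈ Finset.range n₀, u n) (𝓝[<] 1) (𝓝 0) := by
    have : Continuous fun r : ℝ => (1 - r) * ∑ n ∈ Finset.range n₀, u n := by fun_prop
    simpa using (this.tendsto 1).mono_left nhdsWithin_le_nhds
  filter_upwards [hev, hlim.eventually_lt_const (half_pos hε)] with r hr hr'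
  have h1r : 0 < 1 - r := by linarith [hr.2]
  have hnn : 0 ≤ (1 - r) * ∑' n, u n * r ^ n :=
    mul_nonneg h1r.le (tsum_nonneg fun n => mul_nonneg (hu0 n) (pow_nonneg hr.1.le n))
  rw [Real.dist_eq, sub_zero, abs_of_nonneg hnn,
    ← (hsum r hr.1 hr.2).sum_add_tsum_nat_add n₀, mul_add]
  have hA : ∑ n ∈ Finset.range n₀, u n * r ^ n ≤ ∑ n ∈ Finset.range n₀, u n :=
    Finset.sum_le_sum fun n _ => mul_le_of_le_one_right (hu0 n) (pow_le_one₀ hr.1.le hr.2.le)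
  have hT : ∑' n, u (n + n₀) * r ^ (n + n₀) ≤ ∑' n, ε / 2 * r ^ n := by
    refine Summable.tsum_le_tsum (fun n => ?_)
      ((summable_nat_add_iff (f := fun n => u n * r ^ n) n₀).2 (hsum r hr.1 hr.2))
      ((summable_geometric_of_lt_one hr.1.le hr.2).mul_left _)
    exact mul_le_mul (hn₀ _ (by omega)).le (pow_le_pow_of_le_one hr.1.le hr.2.le (by omega))
      (pow_nonneg hr.1.le _) (half_pos hε).le
  rw [tsum_mul_left, tsum_geometric_of_lt_one hr.1.le hr.2] at hT
  have hT' : (1 - r) * ∑' n, u (n + n₀) * r ^ (n + n₀) ≤ ε / 2 := by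
    refine (mul_le_mul_of_nonneg_left hT h1r.le).trans_eq ?_
    field_simp
  have := mul_le_mul_of_nonneg_left hA h1r.le
  linarith

/-- The generating function of the scalar solution is `(1 - z) ^ (α - 1) / ((1 - z) ^ α - z μ)`. -/
theorem generatingFunction_scalarSol {α : ℝ} (hα : 0 < α) {μ z s : ℂ} (hz : ‖z‖ < 1)
    (hs : HasSum (fun n => scalarSol α μ n * z ^ n) s) :
    s * ((1 - z) ^ (α : ℂ) - z * μ) = (1 - z) ^ ((α : ℂ) - 1) := by
  have h := hs.unique (hasSum_recursion hα μ hz (scalarSol_zero α μ) (scalarSol_succ α μ) hs)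
  have h1 : 1 - z ≠ 0 := sub_ne_zero.2 (by rintro rfl; simp at hz)
  have h2 : (1 - z) ^ (α : ℂ) ≠ 0 := by simp [Complex.cpow_eq_zero_iff, h1]
  rw [Complex.cpow_sub _ _ h1, Complex.cpow_one]
  field_simp at h ⊢
  linear_combination h

theorem notMem_rootSet_of_tendsto {α : ℝ} (hα : 0 < α) {μ : ℂ}
    (h : Tendsto (scalarSol α μ) atTop (𝓝 0)) : μ ∉ rootSet α := by
  rintro ⟨z₀, hz₀, hroot⟩
  have hn : Tendsto (fun n => ‖scalarSol α μ n‖) atTop (𝓝 0) := by simpa using h.norm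
  obtain ⟨B, hB⟩ := hn.bddAbove_range
  have hB : ∀ n, ‖scalarSol α μ n‖ ≤ B := fun n => hB ⟨n, rfl⟩
  have hsumn : ∀ z : ℂ, ‖z‖ < 1 → Summable fun n => ‖scalarSol α μ n * z ^ n‖ := fun z hz =>
    Summable.of_nonneg_of_le (fun n => norm_nonneg _)
      (fun n => by
        rw [norm_mul, norm_pow]
        exact mul_le_mul_of_nonneg_right (hB n) (by positivity))
      ((summable_geometric_of_lt_one (norm_nonneg z) hz).mul_left B)
  have hFE : ∀ z : ℂ, ‖z‖ < 1 → (∑' n, scalarSol α μ n * z ^ n) * ((1 - z) ^ (α : ℂ) - z * μ) =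
      (1 - z) ^ ((α : ℂ) - 1) := fun z hz =>
    generatingFunction_scalarSol hα hz (hsumn z hz).of_norm.hasSum
  rcases eq_or_ne z₀ 1 with rfl | h1
  · -- A root at `z = 1` forces `μ = 0`, and then the solution is constant.
    have hμ : μ = 0 := by
      rw [sub_self, Complex.zero_cpow (by exact_mod_cast hα.ne'), one_mul] at hroot
      exact hroot.symm
    have hone : ∀ n, scalarSol α μ n = 1 := by
      intro n
      cases n with
      | zero => exact scalarSol_zero α μ
      | succ n => rw [scalarSol_succ, hμ, zero_mul, add_zero]
    have h := h.congr hone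
    exact one_ne_zero (tendsto_nhds_unique tendsto_const_nhds h)
  have hslit := one_sub_mem_slitPlane hz₀ h1
  have hpow : (1 - z₀) ^ ((α : ℂ) - 1) ≠ 0 := by
    simp [Complex.cpow_eq_zero_iff, Complex.slitPlane_ne_zero hslit]
  rcases hz₀.lt_or_eq with hlt | heq
  · have := hFE z₀ hlt
    rw [hroot, sub_self, mul_zero] at this
    exact hpow this.symm
  -- A root on the unit circle is a pole of the generating function, so that
  -- `(1 - r) ∑ ‖u n‖ r ^ n` stays away from zero as `r` tends to `1`.
  have hev : ∀ᶠ r : ℝ in 𝓝[<] 1, 0 < r ∧ r < 1 := by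
    filter_upwards [Ioo_mem_nhdsLT (show (0 : ℝ) < 1 by norm_num)] with r hr using hr
  have hnr : ∀ r : ℝ, 0 < r → ‖(r : ℂ) * z₀‖ = r := fun r hr => by
    rw [norm_mul, heq, mul_one, Complex.norm_real, Real.norm_of_nonneg hr.le]
  have hray : Tendsto (fun r : ℝ => (r : ℂ) * z₀) (𝓝[<] 1) (𝓝 z₀) := by
    have : Continuous fun r : ℝ => (r : ℂ) * z₀ := by fun_prop
    simpa using (this.tendsto 1).mono_left nhdsWithin_le_nhds
  have hlim1 : Tendsto (fun r : ℝ => (1 - (r : ℂ) * z₀) ^ ((α : ℂ) - 1)) (𝓝[<] 1)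
      (𝓝 ((1 - z₀) ^ ((α : ℂ) - 1))) := by
    have : ContinuousAt (fun z : ℂ => (1 - z) ^ ((α : ℂ) - 1)) z₀ :=
      (DifferentiableAt.cpow_const (by fun_prop) hslit).continuousAt
    exact this.tendsto.comp hray
  have hO : (fun r : ℝ => (1 - (r : ℂ) * z₀) ^ (α : ℂ) - r * z₀ * μ) =O[𝓝[<] 1]
      fun r : ℝ => 1 - r := by
    have hd : DifferentiableAt ℂ (fun z : ℂ => (1 - z) ^ (α : ℂ) - z * μ) z₀ :=
      (DifferentiableAt.cpow_const (by fun_prop) hslit).sub (by fun_prop)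
    have h2 := hd.isBigO_sub.comp_tendsto hray
    refine (h2.congr_left fun r => ?_).trans ?_
    · simp only [Function.comp_apply]
      rw [hroot]
      ring
    · refine Asymptotics.IsBigO.of_bound 1 (Eventually.of_forall fun r => ?_)
      simp only [Function.comp_apply]
      rw [show (r : ℂ) * z₀ - z₀ = ((r - 1 : ℝ) : ℂ) * z₀ by push_cast; ring, norm_mul, heq,
        Complex.norm_real, mul_one, one_mul, norm_sub_rev]
  obtain ⟨C, hC⟩ := hO.bound
  have hz : Tendsto (fun r : ℝ => (1 - (r : ℂ) * z₀) ^ ((α : ℂ) - 1)) (𝓝[<] 1) (𝓝 0) := by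
    refine squeeze_zero_norm' ?_ (by
      simpa using (tendsto_one_sub_mul_tsum (fun n => norm_nonneg _) hn).const_mul C)
    filter_upwards [hev, hC] with r hr hCr
    have hr1 : ‖(r : ℂ) * z₀‖ < 1 := (hnr r hr.1).trans_lt hr.2
    rw [← hFE _ hr1, norm_mul]
    have ht : ‖∑' n, scalarSol α μ n * ((r : ℂ) * z₀) ^ n‖ ≤ ∑' n, ‖scalarSol α μ n‖ * r ^ n := by
      refine (norm_tsum_le_tsum_norm (hsumn _ hr1)).trans_eq ?_
      simp only [norm_mul (scalarSol _ _ _), norm_pow, hnr r hr.1]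
    rw [Real.norm_of_nonneg (by linarith [hr.2] : 0 ≤ 1 - r)] at hCr
    calc _ ≤ (∑' n, ‖scalarSol α μ n‖ * r ^ n) * (C * (1 - r)) :=
          mul_le_mul ht hCr (norm_nonneg _) ((norm_nonneg _).trans ht)
      _ = _ := by ring
  exact hpow (tendsto_nhds_unique hlim1 hz)

/-- The scalar solution is attracted by zero exactly when the characteristic equation has no root
in the closed unit disk. -/
theorem tendsto_scalarSol_iff {α : ℝ} (hα₀ : 0 < α) (hα₁ : α < 1) {μ : ℂ} :
    Tendsto (scalarSol α μ) atTop (𝓝 0) ↔ μ ∉ rootSet α :=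
  ⟨notMem_rootSet_of_tendsto hα₀, tendsto_scalarSol hα₀ hα₁⟩

/-! ### The cardioid in polar coordinates -/

/-- The cardioid `e^{it} (1 - e^{-it})^α` in the plane of the multiplier `μ = λ - 1`. -/
noncomputable def rootCurve (α t : ℝ) : ℂ :=
  Complex.exp (Complex.I * t) * (1 - Complex.exp (-(Complex.I * t))) ^ (α : ℂ)

/-- The polar equation of the cardioid: the distance from the origin of its point in the direction
at angle `φ` from the negative real axis; it is `0` in the directions that the cardioid misses. -/
noncomputable def polarRadius (α φ : ℝ) : ℝ := (2 * max 0 (Real.cos (φ / (2 - α)))) ^ α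

/-- The point at distance `r` from the origin, at angle `φ` from the negative real axis. -/
noncomputable def polarPoint (r φ : ℝ) : ℂ := -((r : ℂ) * Complex.exp (φ * Complex.I))

/-- The bounded side of the cardioid. -/
def innerRegion (α : ℝ) : Set ℂ := {μ | μ ≠ 0 ∧ ‖μ‖ < polarRadius α (-μ).arg}

/-- The unbounded side of the cardioid. -/
def outerRegion (α : ℝ) : Set ℂ := {μ | μ ≠ 0 ∧ polarRadius α (-μ).arg < ‖μ‖}

/-- The points of the cardioid, described by its polar equation. -/
def polarCurve (α : ℝ) : Set ℂ := {μ | μ = 0 ∨ ‖μ‖ = polarRadius α (-μ).arg}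

theorem polarRadius_nonneg (α φ : ℝ) : 0 ≤ polarRadius α φ :=
  Real.rpow_nonneg (mul_nonneg zero_le_two (le_max_left _ _)) _

theorem polarRadius_abs (α φ : ℝ) : polarRadius α |φ| = polarRadius α φ := by
  rcases abs_cases φ with ⟨h, _⟩ | ⟨h, _⟩ <;> rw [h]
  rw [polarRadius, neg_div, Real.cos_neg, polarRadius]

theorem polarRadius_zero (α : ℝ) : polarRadius α 0 = 2 ^ α := by
  simp [polarRadius]

theorem continuous_polarRadius {α : ℝ} (hα : 0 < α) : Continuous (polarRadius α) := by
  unfold polarRadius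
  exact Continuous.rpow_const (by fun_prop) fun _ => Or.inr hα.le

theorem polarRadius_le_of_abs_le {α φ ψ : ℝ} (hα₀ : 0 < α) (hα₁ : α < 1) (h : |φ| ≤ |ψ|)
    (hψ : |ψ| ≤ Real.pi) : polarRadius α ψ ≤ polarRadius α φ := by
  rw [← polarRadius_abs α ψ, ← polarRadius_abs α φ]
  have h2 : (1 : ℝ) ≤ 2 - α := by linarith
  refine Real.rpow_le_rpow (mul_nonneg zero_le_two (le_max_left _ _)) ?_ hα₀.le
  refine mul_le_mul_of_nonneg_left (max_le_max le_rfl ?_) zero_le_two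
  refine Real.cos_le_cos_of_nonneg_of_le_pi (by positivity) ?_ (by gcongr)
  exact (div_le_self (abs_nonneg _) h2).trans hψ

/-- The half-aperture of the sector that contains the cardioid is `(2 - α) π / 2`. -/
theorem polarRadius_pos_iff {α φ : ℝ} (hα₀ : 0 < α) (hα₁ : α < 1) (hφ : |φ| ≤ Real.pi) :
    0 < polarRadius α φ ↔ |φ / (2 - α)| < Real.pi / 2 := by
  have h2 : (1 : ℝ) ≤ 2 - α := by linarith
  have hle : |φ / (2 - α)| ≤ Real.pi := by
    rw [abs_div, abs_of_pos (by linarith : 0 < 2 - α)]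
    exact (div_le_self (abs_nonneg _) h2).trans hφ
  constructor
  · intro h
    by_contra! hc
    have : Real.cos (φ / (2 - α)) ≤ 0 := by
      rw [← Real.cos_abs]
      exact Real.cos_nonpos_of_pi_div_two_le_of_le hc (by linarith [Real.pi_pos])
    rw [polarRadius, max_eq_left this, mul_zero, Real.zero_rpow hα₀.ne'] at h
    exact lt_irrefl _ h
  · intro h
    have : 0 < Real.cos (φ / (2 - α)) := Real.cos_pos_of_mem_Ioo (abs_lt.1 h)
    exact Real.rpow_pos_of_pos (mul_pos two_pos (lt_max_of_lt_right this)) _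

theorem norm_polarPoint {r : ℝ} (hr : 0 ≤ r) (φ : ℝ) : ‖polarPoint r φ‖ = r := by
  rw [polarPoint, norm_neg, norm_mul, Complex.norm_exp_ofReal_mul_I, mul_one, Complex.norm_real,
    Real.norm_of_nonneg hr]

theorem polarPoint_norm_arg (μ : ℂ) : polarPoint ‖μ‖ (-μ).arg = μ := by
  rw [polarPoint, ← norm_neg μ, Complex.norm_mul_exp_arg_mul_I, neg_neg]

theorem arg_neg_polarPoint {r φ : ℝ} (hr : 0 < r) (h1 : -Real.pi < φ) (h2 : φ ≤ Real.pi) :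
    (-polarPoint r φ).arg = φ := by
  rw [polarPoint, neg_neg, Complex.exp_mul_I, Complex.arg_mul_cos_add_sin_mul_I hr ⟨h1, h2⟩]

theorem polarPoint_ne_zero {r : ℝ} (hr : 0 < r) (φ : ℝ) : polarPoint r φ ≠ 0 := by
  rw [← norm_pos_iff, norm_polarPoint hr.le]
  exact hr

theorem polarPoint_zero (φ : ℝ) : polarPoint 0 φ = 0 := by simp [polarPoint]

theorem continuous_polarPoint : Continuous fun x : ℝ × ℝ => polarPoint x.1 x.2 := by
  unfold polarPoint
  fun_prop

/-- With `t = π + s`, one has `1 - e^{-it} = 2 cos (s / 2) e^{-is/2}`, which makes the polar angle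
of the cardioid an affine function of its parameter. -/
theorem rootCurve_pi_add {α s : ℝ} (hα₀ : 0 < α) (hs : |s| ≤ Real.pi) :
    rootCurve α (Real.pi + s) = polarPoint ((2 * Real.cos (s / 2)) ^ α) (s * (1 - α / 2)) := by
  have hs' := abs_le.1 hs
  have hcos : 0 ≤ Real.cos (s / 2) :=
    Real.cos_nonneg_of_mem_Icc ⟨by linarith, by linarith⟩
  have h1 : Complex.exp (Complex.I * (Real.pi + s : ℝ)) = -Complex.exp (s * Complex.I) := by
    push_cast
    rw [mul_add, Complex.exp_add, mul_comm Complex.I, Complex.exp_pi_mul_I, mul_comm Complex.I]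
    ring
  have hE : Complex.exp (s * Complex.I) = Complex.exp ((s / 2 : ℝ) * Complex.I) ^ 2 := by
    rw [← Complex.exp_nat_mul]
    push_cast
    ring_nf
  have h2 : 1 - Complex.exp (-(Complex.I * (Real.pi + s : ℝ))) =
      (2 * Real.cos (s / 2) : ℝ) * Complex.exp ((-(s / 2) : ℝ) * Complex.I) := by
    rw [Complex.exp_neg, h1, hE]
    have hne := Complex.exp_ne_zero ((s / 2 : ℝ) * Complex.I)
    have hc : (2 * Real.cos (s / 2) : ℝ) = Complex.exp ((s / 2 : ℝ) * Complex.I) +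
        (Complex.exp ((s / 2 : ℝ) * Complex.I))⁻¹ := by
      rw [← Complex.exp_neg, Complex.ofReal_mul, Complex.ofReal_cos, Complex.ofReal_ofNat,
        Complex.two_cos, neg_mul]
    rw [hc, Complex.ofReal_neg, neg_mul, Complex.exp_neg]
    field_simp
    ring
  rw [rootCurve, h1, h2]
  rcases hcos.eq_or_lt with h0 | hpos
  · rw [← h0, mul_zero, Real.zero_rpow hα₀.ne', polarPoint_zero]
    simp [hα₀.ne']
  · have hr : 0 < 2 * Real.cos (s / 2) := by positivity
    have harg : ((2 * Real.cos (s / 2) : ℝ) * Complex.exp ((-(s / 2) : ℝ) * Complex.I)).arg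
        = -(s / 2) := by
      rw [Complex.exp_mul_I, Complex.arg_mul_cos_add_sin_mul_I hr
        ⟨by linarith [Real.pi_pos], by linarith [Real.pi_pos]⟩]
    rw [Complex.cpow_ofReal, harg, norm_mul, Complex.norm_exp_ofReal_mul_I, mul_one,
      Complex.norm_real, Real.norm_of_nonneg hr.le, polarPoint, Complex.ofReal_cos,
      Complex.ofReal_sin, ← Complex.exp_mul_I]
    rw [show ((s * (1 - α / 2) : ℝ) : ℂ) * Complex.I =
      s * Complex.I + (-(s / 2) * α : ℝ) * Complex.I by push_cast; ring, Complex.exp_add]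
    ring

theorem rootCurve_image {α : ℝ} (hα₀ : 0 < α) (hα₁ : α < 1) :
    rootCurve α '' Set.Icc 0 (2 * Real.pi) = polarCurve α := by
  have h2α : 0 < 2 - α := by linarith
  ext μ
  constructor
  · rintro ⟨t, ht, rfl⟩
    obtain ⟨s, rfl⟩ : ∃ s, t = Real.pi + s := ⟨t - Real.pi, by ring⟩
    have hs : |s| ≤ Real.pi := abs_le.2 ⟨by linarith [ht.1], by linarith [ht.2]⟩
    have hs' := abs_le.1 hs
    rw [rootCurve_pi_add hα₀ hs]
    have hcos : 0 ≤ Real.cos (s / 2) :=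
      Real.cos_nonneg_of_mem_Icc ⟨by linarith, by linarith⟩
    rcases (Real.rpow_nonneg (mul_nonneg zero_le_two hcos) α).eq_or_lt with h0 | hpos
    · rw [← h0, polarPoint_zero]
      exact Or.inl rfl
    · right
      rw [norm_polarPoint hpos.le, arg_neg_polarPoint hpos, polarRadius,
        show s * (1 - α / 2) / (2 - α) = s / 2 by field_simp, max_eq_right hcos]
      · nlinarith [Real.pi_pos]
      · nlinarith [Real.pi_pos]
  · rintro (rfl | h)
    · exact ⟨0, ⟨le_rfl, Real.two_pi_pos.le⟩, by simp [rootCurve, hα₀.ne']⟩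
    · by_cases hμ : μ = 0
      · subst hμ
        exact ⟨0, ⟨le_rfl, Real.two_pi_pos.le⟩, by simp [rootCurve, hα₀.ne']⟩
      set φ := (-μ).arg with hφ
      have hpos : 0 < polarRadius α φ := h ▸ norm_pos_iff.2 hμ
      have hlt := (polarRadius_pos_iff hα₀ hα₁ (Complex.abs_arg_le_pi _)).1 hpos
      have hlt' := abs_lt.1 hlt
      refine ⟨Real.pi + 2 * (φ / (2 - α)), ⟨by linarith, by linarith⟩, ?_⟩
      rw [rootCurve_pi_add hα₀ (abs_le.2 ⟨by linarith, by linarith⟩), mul_div_cancel_left₀ _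
        (two_ne_zero), show 2 * (φ / (2 - α)) * (1 - α / 2) = φ by field_simp]
      conv_rhs => rw [← polarPoint_norm_arg μ, h, ← hφ]
      rw [polarRadius, max_eq_right (Real.cos_nonneg_of_mem_Icc ⟨hlt'.1.le, hlt'.2.le⟩)]

theorem compl_polarCurve (α : ℝ) : (polarCurve α)ᶜ = innerRegion α ∪ outerRegion α := by
  ext μ
  simp only [innerRegion, outerRegion, polarCurve, Set.mem_union, Set.mem_ofPred_eq,
    Set.mem_compl_iff, not_or, ← and_or_left, ← lt_or_lt_iff_ne]

theorem disjoint_innerRegion_outerRegion (α : ℝ) : Disjoint (innerRegion α) (outerRegion α) :=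
  Set.disjoint_left.2 fun _ h h' => lt_asymm h.2 h'.2

theorem continuousOn_polarRadius_arg {α : ℝ} (hα : 0 < α) :
    ContinuousOn (fun μ : ℂ => polarRadius α (-μ).arg) {0}ᶜ := by
  -- The argument jumps across the negative axis, but its absolute value, an unoriented angle,
  -- is continuous, and `polarRadius` is even.
  intro μ hμ
  have h0 : μ ≠ 0 := hμ
  have h : ContinuousAt (fun μ : ℂ => InnerProductGeometry.angle (1 : ℂ) (-μ)) μ :=
    (InnerProductGeometry.continuousAt_angle (x := ((1 : ℂ), -μ)) one_ne_zero
      (neg_ne_zero.2 h0)).comp (f := fun μ : ℂ => ((1 : ℂ), -μ)) (by fun_prop)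
  have h' := (continuous_polarRadius hα).continuousAt.comp h
  refine (h'.congr ?_).continuousWithinAt
  filter_upwards [isOpen_ne.mem_nhds h0] with ν hν
  rw [Function.comp_apply, Complex.angle_one_left (neg_ne_zero.2 hν), polarRadius_abs]

theorem isOpen_innerRegion {α : ℝ} (hα : 0 < α) : IsOpen (innerRegion α) := by
  have h := ContinuousOn.isOpen_inter_preimage (t := Set.Ioi 0)
    ((continuousOn_polarRadius_arg hα).sub continuous_norm.continuousOn)
    isOpen_compl_singleton isOpen_Ioi
  convert h using 1
  ext μ
  simp [innerRegion]

theorem isOpen_outerRegion {α : ℝ} (hα : 0 < α) : IsOpen (outerRegion α) := by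
  have h := ContinuousOn.isOpen_inter_preimage (t := Set.Iio 0)
    ((continuousOn_polarRadius_arg hα).sub continuous_norm.continuousOn)
    isOpen_compl_singleton isOpen_Iio
  convert h using 1
  ext μ
  simp [outerRegion]

theorem isPreconnected_innerRegion {α : ℝ} (hα₀ : 0 < α) (hα₁ : α < 1) :
    IsPreconnected (innerRegion α) := by
  have h2α : 0 < 2 - α := by linarith
  have hpi := Real.pi_pos
  set b : ℝ := (2 - α) * (Real.pi / 2)
  have hb : b < Real.pi := by simp only [b]; nlinarith
  have hiff : ∀ φ : ℝ, |φ / (2 - α)| < Real.pi / 2 ↔ |φ| < b := fun φ => by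
    rw [abs_div, abs_of_pos h2α, div_lt_iff₀' h2α]
  have himg : innerRegion α = (fun x : ℝ × ℝ => polarPoint (x.2 * polarRadius α x.1) x.1) ''
      (Set.Ioo (-b) b ×ˢ Set.Ioo 0 1) := by
    ext μ
    constructor
    · rintro ⟨h0, h⟩
      have hn := norm_pos_iff.2 h0
      have hρ := hn.trans h
      have hφ := (hiff _).1 ((polarRadius_pos_iff hα₀ hα₁ (Complex.abs_arg_le_pi _)).1 hρ)
      refine ⟨((-μ).arg, ‖μ‖ / polarRadius α (-μ).arg),
        ⟨abs_lt.1 hφ, by positivity, (div_lt_one hρ).2 h⟩, ?_⟩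
      simp only
      rw [div_mul_cancel₀ _ hρ.ne', polarPoint_norm_arg]
    · rintro ⟨⟨φ, s⟩, ⟨hφ, hs0, hs1⟩, rfl⟩
      simp only at hφ hs0 hs1 ⊢
      have hφ' : |φ| < b := abs_lt.2 hφ
      have hρ := (polarRadius_pos_iff hα₀ hα₁ (hφ'.trans hb).le).2 ((hiff φ).2 hφ')
      have hr : 0 < s * polarRadius α φ := mul_pos hs0 hρ
      refine ⟨polarPoint_ne_zero hr _, ?_⟩
      rw [norm_polarPoint hr.le, arg_neg_polarPoint hr (by linarith [hφ.1]) (by linarith [hφ.2])]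
      exact mul_lt_of_lt_one_left hρ hs1
  rw [himg]
  refine (isPreconnected_Ioo.prod isPreconnected_Ioo).image _ (Continuous.continuousOn ?_)
  have := continuous_polarRadius hα₀
  exact continuous_polarPoint.comp (f := fun x : ℝ × ℝ => (x.2 * polarRadius α x.1, x.1))
    (by fun_prop)

theorem isPreconnected_outerRegion {α : ℝ} (hα₀ : 0 < α) : IsPreconnected (outerRegion α) := by
  have himg : outerRegion α = (fun x : ℝ × ℝ => polarPoint (x.2 + polarRadius α x.1) x.1) ''
      (Set.Ioc (-Real.pi) Real.pi ×ˢ Set.Ioi 0) := by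
    ext μ
    constructor
    · rintro ⟨h0, h⟩
      refine ⟨((-μ).arg, ‖μ‖ - polarRadius α (-μ).arg),
        ⟨Complex.arg_mem_Ioc _, sub_pos.2 h⟩, ?_⟩
      simp only
      rw [sub_add_cancel, polarPoint_norm_arg]
    · rintro ⟨⟨φ, s⟩, ⟨hφ, hs⟩, rfl⟩
      have hs : 0 < s := hs
      have hr : 0 < s + polarRadius α φ := add_pos_of_pos_of_nonneg hs (polarRadius_nonneg _ _)
      refine ⟨polarPoint_ne_zero hr _, ?_⟩
      simp only
      rw [norm_polarPoint hr.le, arg_neg_polarPoint hr hφ.1 hφ.2]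
      linarith
  rw [himg]
  refine (isPreconnected_Ioc.prod isPreconnected_Ioi).image _ (Continuous.continuousOn ?_)
  have := continuous_polarRadius hα₀
  exact continuous_polarPoint.comp (f := fun x : ℝ × ℝ => (x.2 + polarRadius α x.1, x.1))
    (by fun_prop)

theorem ofReal_mem_outerRegion {α x : ℝ} (hα₀ : 0 < α) (hα₁ : α < 1) (hx : 0 < x) :
    (x : ℂ) ∈ outerRegion α := by
  refine ⟨by exact_mod_cast hx.ne', ?_⟩
  rw [← Complex.ofReal_neg, Complex.arg_ofReal_of_neg (by linarith), Complex.norm_real,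
    Real.norm_of_nonneg hx.le]
  refine lt_of_le_of_lt (le_of_not_gt fun h => ?_) hx
  rw [polarRadius_pos_iff hα₀ hα₁ (abs_of_pos Real.pi_pos).le, abs_of_pos
    (div_pos Real.pi_pos (by linarith)), div_lt_div_iff_of_pos_left Real.pi_pos (by linarith)
    two_pos] at h
  linarith

/-- On the real axis the bounded side of the cardioid is the interval `(-2 ^ α, 0)`. -/
theorem ofReal_mem_innerRegion {α x : ℝ} (hα₀ : 0 < α) (hα₁ : α < 1) :
    (x : ℂ) ∈ innerRegion α ↔ -2 ^ α < x ∧ x < 0 := by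
  rcases lt_trichotomy x 0 with hx | rfl | hx
  · rw [innerRegion, Set.mem_ofPred_eq, ← Complex.ofReal_neg, Complex.arg_ofReal_of_nonneg
      (by linarith), polarRadius_zero, Complex.norm_real, Real.norm_of_nonpos hx.le]
    constructor
    · rintro ⟨-, h⟩
      exact ⟨by linarith, hx⟩
    · rintro ⟨h, -⟩
      exact ⟨by exact_mod_cast hx.ne, by linarith⟩
  · simp [innerRegion]
  · refine iff_of_false (fun h => ?_) fun h => lt_asymm h.2 hx
    exact Set.disjoint_left.1 (disjoint_innerRegion_outerRegion α) h
      (ofReal_mem_outerRegion hα₀ hα₁ hx)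

/-- To the left of the imaginary axis, the vertical sections of the bounded side of the cardioid
are symmetric intervals: moving towards the real axis decreases both the modulus and the angle
from the negative real axis. -/
theorem mem_innerRegion_of_abs_im_le {α : ℝ} (hα₀ : 0 < α) (hα₁ : α < 1) {μ ν : ℂ}
    (hμ : μ ∈ innerRegion α) (hre : ν.re = μ.re) (hneg : μ.re < 0) (him : |ν.im| ≤ |μ.im|) :
    ν ∈ innerRegion α := by
  have hν0 : ν ≠ 0 := by
    rintro rfl
    rw [← hre] at hneg
    simp at hneg
  have hnorm : ‖ν‖ ≤ ‖μ‖ := by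
    rw [Complex.norm_def, Complex.norm_def]
    refine Real.sqrt_le_sqrt ?_
    rw [Complex.normSq_apply, Complex.normSq_apply, hre]
    have := sq_le_sq.2 him
    nlinarith
  refine ⟨hν0, (hnorm.trans_lt hμ.2).trans_le ?_⟩
  refine polarRadius_le_of_abs_le hα₀ hα₁ ?_ (Complex.abs_arg_le_pi _)
  refine (Real.strictAntiOn_cos.le_iff_ge ⟨abs_nonneg _, Complex.abs_arg_le_pi _⟩
    ⟨abs_nonneg _, Complex.abs_arg_le_pi _⟩).1 ?_
  rw [Real.cos_abs, Real.cos_abs, Complex.cos_arg (neg_ne_zero.2 hμ.1),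
    Complex.cos_arg (neg_ne_zero.2 hν0), norm_neg, norm_neg, Complex.neg_re, Complex.neg_re, hre]
  have := norm_pos_iff.2 hν0
  have : 0 ≤ -μ.re := by linarith
  gcongr

/-! ### Characteristic roots and the interior of the cardioid -/

theorem isClosed_rootSet {α : ℝ} (hα : 0 < α) : IsClosed (rootSet α) := by
  have himg : rootSet α = Prod.snd '' {x : Metric.closedBall (0 : ℂ) 1 × ℂ |
      (1 - (x.1 : ℂ)) ^ (α : ℂ) = x.1 * x.2} := by
    ext μ
    constructor
    · rintro ⟨z, hz, h⟩
      exact ⟨(⟨z, by simpa using hz⟩, μ), h, rfl⟩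
    · rintro ⟨⟨⟨z, hz⟩, μ⟩, h, rfl⟩
      exact ⟨z, by simpa using hz, h⟩
  rw [himg]
  refine isClosedMap_snd_of_compactSpace _ (isClosed_eq ?_ (by fun_prop))
  refine continuous_iff_continuousAt.2 fun x => ?_
  exact (continuousAt_one_sub_cpow hα (z := (x.1 : ℂ)) (mem_closedBall_zero_iff.1 x.1.2)).comp
    (f := fun x : Metric.closedBall (0 : ℂ) 1 × ℂ => (x.1 : ℂ)) (by fun_prop)

theorem isOpen_compl_polarCurve {α : ℝ} (hα : 0 < α) : IsOpen (polarCurve α)ᶜ := by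
  rw [compl_polarCurve]
  exact (isOpen_innerRegion hα).union (isOpen_outerRegion hα)

/-- A root on the unit circle puts `μ` on the cardioid. -/
theorem mem_polarCurve_of_norm_eq_one {α : ℝ} (hα₀ : 0 < α) (hα₁ : α < 1) {μ z : ℂ}
    (hz : ‖z‖ = 1) (h : (1 - z) ^ (α : ℂ) = z * μ) : μ ∈ polarCurve α := by
  obtain ⟨θ, hθ⟩ : ∃ θ : ℝ, z⁻¹ = Complex.exp (Complex.I * θ) ∧ 0 ≤ θ ∧ θ ≤ 2 * Real.pi := by
    refine ⟨Real.pi + (-z⁻¹).arg, ?_, ?_, ?_⟩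
    · have h1 := Complex.norm_mul_exp_arg_mul_I (-z⁻¹)
      rw [norm_neg, norm_inv, hz, inv_one, Complex.ofReal_one, one_mul] at h1
      push_cast
      rw [mul_add, Complex.exp_add, mul_comm Complex.I, Complex.exp_pi_mul_I, mul_comm Complex.I,
        h1]
      ring
    · linarith [Complex.neg_pi_lt_arg (-z⁻¹)]
    · linarith [Complex.arg_le_pi (-z⁻¹)]
  rw [← rootCurve_image hα₀ hα₁]
  refine ⟨θ, hθ.2, ?_⟩
  have hz0 : z ≠ 0 := by
    rintro rfl
    simp at hz
  rw [rootCurve, Complex.exp_neg, ← hθ.1, inv_inv, h, inv_mul_cancel_left₀ hz0]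

theorem polarCurve_subset_rootSet {α : ℝ} (hα₀ : 0 < α) (hα₁ : α < 1) :
    polarCurve α ⊆ rootSet α := by
  rw [← rootCurve_image hα₀ hα₁]
  rintro _ ⟨t, -, rfl⟩
  refine ⟨Complex.exp (-(Complex.I * t)), ?_, ?_⟩
  · rw [← mul_neg, mul_comm, ← Complex.ofReal_neg, Complex.norm_exp_ofReal_mul_I]
  · rw [rootCurve, ← mul_assoc, ← Complex.exp_add, neg_add_cancel, Complex.exp_zero, one_mul]

/-- `z ↦ (1 - z) ^ α / z` is a local homeomorphism of the punctured unit disk, since its derivative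
vanishes only where `(1 - α) z = 1`. -/
theorem isOpen_rootSet_diff {α : ℝ} (hα₀ : 0 < α) (hα₁ : α < 1) :
    IsOpen (rootSet α ∩ (polarCurve α)ᶜ) := by
  rw [isOpen_iff_mem_nhds]
  rintro μ ⟨⟨z, hz, h⟩, hμ⟩
  refine inter_mem ?_ ((isOpen_compl_polarCurve hα₀).mem_nhds hμ)
  have hlt : ‖z‖ < 1 := lt_of_le_of_ne hz fun h1 =>
    hμ (mem_polarCurve_of_norm_eq_one hα₀ hα₁ h1 h)
  have hz0 : z ≠ 0 := by
    rintro rfl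
    simp at h
  have hz1 : z ≠ 1 := by
    rintro rfl
    simp at hlt
  have hslit := one_sub_mem_slitPlane hz hz1
  have h1z : 1 - z ≠ 0 := Complex.slitPlane_ne_zero hslit
  have hd := ((((hasStrictDerivAt_id z).const_sub 1).cpow_const (c := (α : ℂ)) hslit).div
    (hasStrictDerivAt_id z) hz0)
  have hd0 : (1 - α) * z - 1 ≠ 0 := by
    intro h0
    have h1 : ‖((1 - α : ℝ) : ℂ) * z‖ = 1 := by
      push_cast
      rw [sub_eq_zero.1 h0, norm_one]
    rw [norm_mul, Complex.norm_real, Real.norm_of_nonneg (by linarith)] at h1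
    nlinarith [norm_nonneg z]
  have hpow : (1 - z) ^ (α : ℂ) ≠ 0 := by simp [Complex.cpow_eq_zero_iff, h1z]
  have hmap := hd.map_nhds_eq (by
    simp only [id]
    rw [Complex.cpow_sub _ _ h1z, Complex.cpow_one]
    refine div_ne_zero ?_ (pow_ne_zero _ hz0)
    have : α * ((1 - z) ^ (α : ℂ) / (1 - z)) * -1 * z - (1 - z) ^ (α : ℂ) * 1 =
        (1 - z) ^ (α : ℂ) / (1 - z) * ((1 - α) * z - 1) := by
      field_simp
      ring
    rw [this]
    exact mul_ne_zero (div_ne_zero hpow h1z) hd0)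
  have hμeq : μ = (1 - z) ^ (α : ℂ) / z := by
    rw [h, mul_div_cancel_left₀ _ hz0]
  rw [hμeq]
  refine mem_of_superset (hmap ▸ image_mem_map
    (inter_mem (Metric.isOpen_ball.mem_nhds (by simpa using hlt : z ∈ Metric.ball (0 : ℂ) 1))
      (isOpen_ne.mem_nhds hz0))) ?_
  rintro _ ⟨w, ⟨hw, hw0⟩, rfl⟩
  have hw0 : w ≠ 0 := hw0
  exact ⟨w, (by simpa using hw : ‖w‖ < 1).le, (mul_div_cancel₀ _ hw0).symm⟩

theorem neg_half_notMem_rootSet {α : ℝ} (hα₀ : 0 < α) (hα₁ : α < 1) :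
    ((-(1 / 2) : ℝ) : ℂ) ∉ rootSet α := by
  rintro ⟨z, hz, h⟩
  have hnorm : ‖1 - z‖ < 1 := by
    have h1 := congrArg norm h
    rw [Complex.norm_cpow_real, norm_mul, Complex.norm_real, Real.norm_eq_abs] at h1
    by_contra! hc
    have := Real.one_le_rpow hc hα₀.le
    rw [h1] at this
    norm_num at this
    linarith
  have hre : 0 < z.re := by
    have := (Complex.re_le_norm (1 - z)).trans_lt hnorm
    simpa using this
  have h2 := congrArg Complex.re h
  rw [Complex.cpow_ofReal_re, Complex.re_mul_ofReal] at h2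
  have harg : |(1 - z).arg| ≤ Real.pi / 2 :=
    Complex.abs_arg_le_pi_div_two_iff.2 (re_one_sub_nonneg hz)
  have hcos : 0 ≤ Real.cos ((1 - z).arg * α) := by
    refine Real.cos_nonneg_of_mem_Icc (abs_le.1 ?_)
    rw [abs_mul, abs_of_pos hα₀]
    nlinarith [abs_nonneg (1 - z).arg]
  have := mul_nonneg (Real.rpow_nonneg (norm_nonneg (1 - z)) α) hcos
  linarith

/-- The set of multipliers without characteristic root in the closed unit disk is open and closed
off the cardioid, so it is a union of sides of the cardioid; it contains `-1/2` and omits a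
positive number. -/
theorem compl_rootSet {α : ℝ} (hα₀ : 0 < α) (hα₁ : α < 1) : (rootSet α)ᶜ = innerRegion α := by
  have hu := (isClosed_rootSet hα₀).isOpen_compl
  have hv := isOpen_rootSet_diff hα₀ hα₁
  have hdisj : Disjoint (rootSet α)ᶜ (rootSet α ∩ (polarCurve α)ᶜ) :=
    Set.disjoint_left.2 fun _ h h' => h h'.1
  have hcover : innerRegion α ∪ outerRegion α ⊆
      (rootSet α)ᶜ ∪ (rootSet α ∩ (polarCurve α)ᶜ) := fun μ hμ => by
    rw [← compl_polarCurve] at hμ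
    by_cases h : μ ∈ rootSet α
    · exact Or.inr ⟨h, hμ⟩
    · exact Or.inl h
  refine Set.Subset.antisymm ?_ ?_
  · have hout : outerRegion α ⊆ rootSet α ∩ (polarCurve α)ᶜ := by
      refine (isPreconnected_outerRegion hα₀).subset_left_of_subset_union hv hu hdisj.symm
        (by rw [Set.union_comm]; exact Set.subset_union_right.trans hcover) ?_
      have hmem := ofReal_mem_outerRegion hα₀ hα₁
        (show 0 < (1 / 2 : ℝ) ^ α / (1 / 2) by positivity)
      refine ⟨_, hmem, ⟨(1 / 2 : ℝ), ?_, ?_⟩, ?_⟩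
      · rw [Complex.norm_real, Real.norm_of_nonneg (by norm_num)]
        norm_num
      · rw [← Complex.ofReal_one, ← Complex.ofReal_sub, ← Complex.ofReal_cpow (by norm_num),
          ← Complex.ofReal_mul, mul_div_cancel₀ _ (by norm_num)]
        norm_num
      · rw [compl_polarCurve]
        exact Or.inr hmem
    intro μ hμ
    have hc : μ ∈ (polarCurve α)ᶜ := fun h => hμ (polarCurve_subset_rootSet hα₀ hα₁ h)
    rw [compl_polarCurve] at hc
    exact hc.resolve_right fun h => hμ (hout h).1
  · refine (isPreconnected_innerRegion hα₀ hα₁).subset_left_of_subset_union hu hv hdisj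
      (Set.subset_union_left.trans hcover) ⟨_, ?_, neg_half_notMem_rootSet hα₀ hα₁⟩
    refine (ofReal_mem_innerRegion hα₀ hα₁).2 ⟨?_, by norm_num⟩
    have := Real.one_le_rpow (one_le_two (α := ℝ)) hα₀.le
    linarith

/-- A curve whose complement splits into two connected open sets, one bounded and the other
unbounded, encloses the bounded one. -/
theorem inside_eq_of_compl_eq {C D E : Set (ℝ × ℝ)} (hC : Cᶜ = D ∪ E) (hDE : Disjoint D E)
    (hDo : IsOpen D) (hEo : IsOpen E) (hEc : IsPreconnected E)
    (hDb : Bornology.IsBounded D) (hEb : ¬ Bornology.IsBounded E) : inside C = D := by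
  ext p
  constructor
  · rintro ⟨hp, hb⟩
    have hp' : p ∈ D ∪ E := hC ▸ hp
    refine hp'.resolve_right fun hE => hEb (hb.subset ?_)
    exact hEc.subset_connectedComponentIn hE (hC ▸ Set.subset_union_right)
  · intro hp
    have hpC : p ∈ Cᶜ := hC ▸ Or.inl hp
    refine ⟨hpC, hDb.subset ?_⟩
    exact isPreconnected_connectedComponentIn.subset_left_of_subset_union hDo hEo hDE
      (hC ▸ connectedComponentIn_subset _ _) ⟨p, mem_connectedComponentIn hpC, hp⟩

/-- The affine change of coordinates `(a₁, a₂) ↦ (a₁ - 1) + 2 i s a₂` from the parameter plane to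
the plane of the multiplier `μ = λ - 1`. -/
noncomputable def multiplier (s : ℝ) (p : ℝ × ℝ) : ℂ := ⟨p.1 - 1, 2 * s * p.2⟩

/-- The inverse of `multiplier`, for `s ≠ 0`. -/
noncomputable def multiplierInv (s : ℝ) (μ : ℂ) : ℝ × ℝ := (μ.re + 1, 1 / (2 * s) * μ.im)

theorem multiplier_multiplierInv {s : ℝ} (hs : s ≠ 0) (μ : ℂ) :
    multiplier s (multiplierInv s μ) = μ := by
  apply Complex.ext
  · simp [multiplier, multiplierInv]
  · simp only [multiplier, multiplierInv]
    field_simp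

theorem multiplierInv_multiplier {s : ℝ} (hs : s ≠ 0) (p : ℝ × ℝ) :
    multiplierInv s (multiplier s p) = p := by
  apply Prod.ext
  · simp [multiplier, multiplierInv]
  · simp only [multiplier, multiplierInv]
    field_simp

theorem continuous_multiplier (s : ℝ) : Continuous (multiplier s) := by
  refine Complex.equivRealProdCLM.symm.continuous.comp
    (g := Complex.equivRealProdCLM.symm) (f := fun p : ℝ × ℝ => (p.1 - 1, 2 * s * p.2)) ?_
  fun_prop

theorem continuous_multiplierInv (s : ℝ) : Continuous (multiplierInv s) := by
  unfold multiplierInv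
  fun_prop

theorem preimage_multiplier {s : ℝ} (hs : s ≠ 0) (S : Set ℂ) :
    multiplier s ⁻¹' S = multiplierInv s '' S :=
  (congrFun (Set.image_eq_preimage_of_inverse (multiplier_multiplierInv hs)
    (multiplierInv_multiplier hs)) S).symm

theorem innerRegion_subset_closedBall {α : ℝ} (hα₀ : 0 < α) :
    innerRegion α ⊆ Metric.closedBall 0 (2 ^ α) := by
  intro μ hμ
  rw [mem_closedBall_zero_iff]
  refine hμ.2.le.trans (Real.rpow_le_rpow (mul_nonneg zero_le_two (le_max_left _ _)) ?_ hα₀.le)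
  have := Real.cos_le_one ((-μ).arg / (2 - α))
  have := max_le zero_le_one this
  linarith

theorem cardioidInterior_eq {α : ℝ} (hα₀ : 0 < α) (hα₁ : α < 1) {N j : ℕ}
    (hs : Real.sin (2 * Real.pi * j / N) ≠ 0) :
    cardioidInterior α N j = multiplier (Real.sin (2 * Real.pi * j / N)) ⁻¹' innerRegion α := by
  set s := Real.sin (2 * Real.pi * j / N) with hsdef
  have hcurve : cardioid α N j '' Set.Icc 0 (2 * Real.pi) = multiplier s ⁻¹' polarCurve α := by
    rw [preimage_multiplier hs, ← rootCurve_image hα₀ hα₁, Set.image_image]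
    rfl
  have hcont := continuous_multiplier s
  rw [cardioidInterior, hcurve]
  refine inside_eq_of_compl_eq (E := multiplier s ⁻¹' outerRegion α) ?_ ?_
    ((isOpen_innerRegion hα₀).preimage hcont) ((isOpen_outerRegion hα₀).preimage hcont) ?_ ?_ ?_
  · rw [← Set.preimage_compl, compl_polarCurve, Set.preimage_union]
  · exact (disjoint_innerRegion_outerRegion α).preimage _
  · rw [preimage_multiplier hs]
    exact (isPreconnected_outerRegion hα₀).image _ (continuous_multiplierInv s).continuousOn
  · rw [preimage_multiplier hs]
    exact (((isCompact_closedBall _ _).image (continuous_multiplierInv s)).isBounded).subset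
      (Set.image_mono (innerRegion_subset_closedBall hα₀))
  · intro hb
    obtain ⟨R, hR⟩ := isBounded_iff_forall_norm_le.1 hb
    have hmem : ((1 + (|R| + 1), 0) : ℝ × ℝ) ∈ multiplier s ⁻¹' outerRegion α := by
      have : multiplier s (1 + (|R| + 1), 0) = ((|R| + 1 : ℝ) : ℂ) := by
        apply Complex.ext <;> simp [multiplier]
      rw [Set.mem_preimage, this]
      exact ofReal_mem_outerRegion hα₀ hα₁ (by positivity)
    have h1 := (norm_fst_le _).trans (hR _ hmem)
    have h2 := (le_abs_self _).trans h1
    linarith [le_abs_self R]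

theorem multiplier_mem_innerRegion_of_abs_le {α : ℝ} (hα₀ : 0 < α) (hα₁ : α < 1) {s s' : ℝ}
    {p : ℝ × ℝ} (hp : p.1 < 1) (hs : |s'| ≤ |s|) (h : multiplier s p ∈ innerRegion α) :
    multiplier s' p ∈ innerRegion α := by
  refine mem_innerRegion_of_abs_im_le hα₀ hα₁ h rfl (sub_neg.2 hp) ?_
  simp only [multiplier, abs_mul]
  gcongr

/-! ### Reduction to the scalar equation -/

section Diagonalization
variable {ι : Type*}

theorem isSolution_iff [Fintype ι] [DecidableEq ι] {α : ℝ} {A : Matrix ι ι ℝ} {X : ℕ → ι → ℝ} :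
    IsSolution α A X ↔ ∀ t m, X (t + 1) m = X 0 m +
      ∑ j ∈ Finset.range (t + 1), kernelCoeff α (t - j) * Matrix.mulVec (A - 1) (X j) m := by
  have h : ∀ t, ∑ j ∈ Finset.range (t + 1),
      (Real.Gamma ((t : ℝ) - j + α) / (Real.Gamma α * Real.Gamma ((t : ℝ) - j + 1))) •
        Matrix.mulVec (A - 1) (X j) =
      ∑ j ∈ Finset.range (t + 1), kernelCoeff α (t - j) • Matrix.mulVec (A - 1) (X j) := by
    intro t
    refine Finset.sum_congr rfl fun j hj => ?_
    rw [kernelCoeff, Nat.cast_sub (Nat.lt_succ_iff.1 (Finset.mem_range.1 hj))]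
  simp only [IsSolution, h, funext_iff, Pi.add_apply, Finset.sum_apply, Pi.smul_apply, smul_eq_mul]

theorem mulVec_re [Fintype ι] (M : Matrix ι ι ℝ) (z : ι → ℂ) (m : ι) :
    M.mulVec (fun k => (z k).re) m = ((M.map (fun x : ℝ => (x : ℂ))).mulVec z m).re := by
  simp [Matrix.mulVec, dotProduct]

theorem mulVec_ofReal [Fintype ι] (M : Matrix ι ι ℝ) (x : ι → ℝ) (m : ι) :
    ((M.mulVec x m : ℝ) : ℂ) = (M.map (fun x : ℝ => (x : ℂ))).mulVec (fun k => (x k : ℂ)) m := by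
  simp [Matrix.mulVec, dotProduct]

theorem map_sub_one [DecidableEq ι] (A : Matrix ι ι ℝ) :
    (A - 1).map (fun x : ℝ => (x : ℂ)) = A.map (fun x : ℝ => (x : ℂ)) - 1 := by
  ext i j
  by_cases h : i = j <;> simp [h]

/-- An eigenvector of `A` gives a complex solution, whose real part is a solution. -/
theorem isSolution_re [Fintype ι] [DecidableEq ι] {α : ℝ} {A : Matrix ι ι ℝ} {l : ℂ} {w : ι → ℂ}
    (hw : (A.map (fun x : ℝ => (x : ℂ))).mulVec w = l • w) :
    IsSolution α A fun t m => (scalarSol α (l - 1) t * w m).re := by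
  rw [isSolution_iff]
  intro t m
  have h : ∀ j, (A - 1).mulVec (fun m => (scalarSol α (l - 1) j * w m).re) m =
      (scalarSol α (l - 1) j * ((l - 1) * w m)).re := by
    intro j
    rw [mulVec_re, map_sub_one]
    have : (fun k => scalarSol α (l - 1) j * w k) = scalarSol α (l - 1) j • w := rfl
    rw [this, Matrix.mulVec_smul, Matrix.sub_mulVec, hw, Matrix.one_mulVec]
    simp only [Pi.smul_apply, Pi.sub_apply, smul_eq_mul]
    ring_nf
  simp only [h]
  rw [scalarSol_zero, one_mul, scalarSol_succ]
  simp only [← Complex.re_ofReal_mul, ← Complex.re_sum, ← Complex.add_re]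
  congr 1
  rw [add_mul, one_mul, Finset.mul_sum, Finset.sum_mul]
  congr 1
  refine Finset.sum_congr rfl fun j _ => ?_
  ring

variable [Fintype ι] [DecidableEq ι] {α : ℝ} {A : Matrix ι ι ℝ} {P Q : Matrix ι ι ℂ} {d : ι → ℂ}

/-- In the eigenbasis given by the columns of `P`, each coordinate of a solution is a multiple of
the scalar solution for the corresponding eigenvalue. -/
theorem solution_eq (hPQ : P * Q = 1) (hQP : Q * P = 1)
    (hA : A.map (fun x : ℝ => (x : ℂ)) * P = P * Matrix.diagonal d)
    {X : ℕ → ι → ℝ} (hX : IsSolution α A X) (t : ℕ) (k : ι) :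
    (X t k : ℂ) = ∑ i, P k i *
      ((Q.mulVec fun m => (X 0 m : ℂ)) i * scalarSol α (d i - 1) t) := by
  set Z : ℕ → ι → ℂ := fun t m => (X t m : ℂ)
  have hQA : Q * A.map (fun x : ℝ => (x : ℂ)) = Matrix.diagonal d * Q := by
    calc _ = Q * (A.map (fun x : ℝ => (x : ℂ)) * P) * Q := by
          rw [Matrix.mul_assoc, Matrix.mul_assoc, hPQ, Matrix.mul_one]
      _ = _ := by rw [hA, ← Matrix.mul_assoc, hQP, Matrix.one_mul]
  have hstep : ∀ t, Z (t + 1) = Z 0 + ∑ j ∈ Finset.range (t + 1), (kernelCoeff α (t - j) : ℂ) •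
      (A.map (fun x : ℝ => (x : ℂ)) - 1).mulVec (Z j) := by
    intro t
    funext m
    have := congrArg (fun x : ℝ => (x : ℂ)) (isSolution_iff.1 hX t m)
    simp only [Complex.ofReal_add, Complex.ofReal_sum, Complex.ofReal_mul, mulVec_ofReal,
      map_sub_one] at this
    simpa [Finset.sum_apply] using this
  have hy : ∀ i t, Q.mulVec (Z t) i = Q.mulVec (Z 0) i * scalarSol α (d i - 1) t := by
    intro i t
    refine eq_mul_scalarSol (c := fun t => Q.mulVec (Z t) i) (fun t => ?_) t
    rw [hstep, Matrix.mulVec_add, Matrix.mulVec_sum, Pi.add_apply, Finset.sum_apply,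
      Finset.mul_sum]
    congr 1
    refine Finset.sum_congr rfl fun j _ => ?_
    rw [Matrix.mulVec_smul, Matrix.mulVec_mulVec, Matrix.mul_sub, hQA, Matrix.mul_one,
      Matrix.sub_mulVec, ← Matrix.mulVec_mulVec, Pi.smul_apply, Pi.sub_apply,
      Matrix.mulVec_diagonal, smul_eq_mul]
    ring
  have h1 : Z t = P.mulVec (Q.mulVec (Z t)) := by
    rw [Matrix.mulVec_mulVec, hPQ, Matrix.one_mulVec]
  have h2 : Z t k = ∑ i, P k i * Q.mulVec (Z t) i := congrFun h1 k
  refine h2.trans (Finset.sum_congr rfl fun i _ => ?_)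
  rw [hy]

/-- A diagonalizable system is asymptotically stable exactly when all its scalar components
tend to zero. -/
theorem asymptoticallyStable_iff (hPQ : P * Q = 1) (hQP : Q * P = 1)
    (hA : A.map (fun x : ℝ => (x : ℂ)) * P = P * Matrix.diagonal d) :
    AsymptoticallyStable α A ↔ ∀ i, Tendsto (scalarSol α (d i - 1)) atTop (𝓝 0) := by
  constructor
  · rintro ⟨-, η, hη, hattr⟩ i
    set v : ι → ℂ := fun m => P m i
    have hv : (A.map (fun x : ℝ => (x : ℂ))).mulVec v = d i • v := by
      funext m
      have := congrFun (congrFun hA m) i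
      rw [Matrix.mul_diagonal, mul_comm] at this
      exact this
    obtain ⟨k, hk⟩ : ∃ k, v k ≠ 0 := by
      by_contra! h
      have := congrFun (congrFun hQP i) i
      rw [Matrix.mul_apply, Matrix.one_apply_eq] at this
      simp [v] at h
      simp [h] at this
    have hkey : ∀ c : ℂ, ‖c‖ * ‖v‖ < η →
        Tendsto (fun t => (scalarSol α (d i - 1) t * (c * v k)).re) atTop (𝓝 0) := by
      intro c hc
      have hcv : (A.map (fun x : ℝ => (x : ℂ))).mulVec (c • v) = d i • (c • v) := by
        rw [Matrix.mulVec_smul, hv, smul_comm]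
      have := hattr _ (isSolution_re (α := α) hcv) ?_
      · exact (tendsto_pi_nhds.1 this) k
      · rw [pi_norm_lt_iff hη]
        intro m
        rw [scalarSol_zero, one_mul, Real.norm_eq_abs]
        refine (Complex.abs_re_le_norm _).trans_lt (lt_of_le_of_lt ?_ hc)
        rw [← norm_smul]
        exact norm_le_pi_norm (c • v) m
    set δ : ℝ := η / (‖v‖ + 1)
    have hδ : 0 < δ := by positivity
    have hδv : δ * ‖v‖ < η := by
      have : δ * (‖v‖ + 1) = η := div_mul_cancel₀ _ (by positivity)
      nlinarith
    have hre := hkey (δ : ℂ) (by rwa [Complex.norm_real, Real.norm_of_nonneg hδ.le])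
    have him := hkey (-Complex.I * δ) (by
      rwa [norm_mul, norm_neg, Complex.norm_I, one_mul, Complex.norm_real,
        Real.norm_of_nonneg hδ.le])
    have hz : Tendsto (fun t => scalarSol α (d i - 1) t * (δ * v k)) atTop (𝓝 0) := by
      have h := ((Complex.continuous_ofReal.tendsto 0).comp hre).add
        (((Complex.continuous_ofReal.tendsto 0).comp him).mul_const Complex.I)
      simp only [Complex.ofReal_zero, zero_mul, add_zero] at h
      refine h.congr fun t => ?_
      apply Complex.ext
      · simp
      · simp
        ring
    have hne : (δ : ℂ) * v k ≠ 0 := mul_ne_zero (by exact_mod_cast hδ.ne') hk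
    have h := hz.mul_const ((δ : ℂ) * v k)⁻¹
    rw [zero_mul] at h
    exact h.congr fun t => mul_inv_cancel_right₀ hne _
  · intro h
    constructor
    · have hB : ∀ i, ∃ B, ∀ t, ‖scalarSol α (d i - 1) t‖ ≤ B := fun i => by
        obtain ⟨B, hB⟩ := (h i).norm.bddAbove_range
        exact ⟨B, fun t => hB ⟨t, rfl⟩⟩
      choose B hB using hB
      have hB0 : ∀ i, 0 ≤ B i := fun i => (norm_nonneg _).trans (hB i 0)
      set K : ℝ := ∑ k, ∑ i, ‖P k i‖ * ((∑ m, ‖Q i m‖) * B i)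
      have hterm : ∀ k i, 0 ≤ ‖P k i‖ * ((∑ m, ‖Q i m‖) * B i) := fun k i =>
        mul_nonneg (norm_nonneg _)
          (mul_nonneg (Finset.sum_nonneg fun _ _ => norm_nonneg _) (hB0 i))
      have hK0 : 0 ≤ K := Finset.sum_nonneg fun k _ => Finset.sum_nonneg fun i _ => hterm k i
      have hbound : ∀ X, IsSolution α A X → ∀ t, ‖X t‖ ≤ K * ‖X 0‖ := by
        intro X hX t
        rw [pi_norm_le_iff_of_nonneg (by positivity)]
        intro k
        rw [← Complex.norm_real, solution_eq hPQ hQP hA hX]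
        have hQ : ∀ i, ‖(Q.mulVec fun m => (X 0 m : ℂ)) i‖ ≤ (∑ m, ‖Q i m‖) * ‖X 0‖ := by
          intro i
          rw [Matrix.mulVec, dotProduct, Finset.sum_mul]
          refine norm_sum_le_of_le _ fun m _ => ?_
          rw [norm_mul, Complex.norm_real]
          exact mul_le_mul_of_nonneg_left (norm_le_pi_norm _ m) (norm_nonneg _)
        calc _ ≤ ∑ i, ‖P k i‖ * ((∑ m, ‖Q i m‖) * B i) * ‖X 0‖ := by
              refine norm_sum_le_of_le _ fun i _ => ?_
              rw [norm_mul, norm_mul, mul_assoc, mul_assoc, mul_comm (B i), ← mul_assoc (∑ m, _)]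
              exact mul_le_mul_of_nonneg_left (mul_le_mul (hQ i) (hB i t) (norm_nonneg _)
                ((norm_nonneg _).trans (hQ i))) (norm_nonneg _)
          _ = (∑ i, ‖P k i‖ * ((∑ m, ‖Q i m‖) * B i)) * ‖X 0‖ := by rw [Finset.sum_mul]
          _ ≤ K * ‖X 0‖ := by
              refine mul_le_mul_of_nonneg_right ?_ (norm_nonneg _)
              exact Finset.single_le_sum (f := fun k => ∑ i, ‖P k i‖ * ((∑ m, ‖Q i m‖) * B i))
                (fun k _ => Finset.sum_nonneg fun i _ => hterm k i) (Finset.mem_univ k)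
      intro ε hε
      refine ⟨ε / (K + 1), by positivity, fun X hX h0 t => ?_⟩
      rw [lt_div_iff₀ (by positivity)] at h0
      have := hbound X hX t
      nlinarith [norm_nonneg (X 0)]
    · refine ⟨1, one_pos, fun X hX _ => tendsto_pi_nhds.2 fun k => ?_⟩
      have hlim : Tendsto (fun t => ∑ i, P k i *
          ((Q.mulVec fun m => (X 0 m : ℂ)) i * scalarSol α (d i - 1) t)) atTop (𝓝 0) := by
        have := tendsto_finsetSum (Finset.univ : Finset ι) fun i _ =>
          ((h i).const_mul ((Q.mulVec fun m => (X 0 m : ℂ)) i)).const_mul (P k i)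
        simpa using this
      have hre := (Complex.continuous_re.tendsto 0).comp hlim
      refine hre.congr fun t => ?_
      rw [Function.comp_apply, ← solution_eq hPQ hQP hA hX, Complex.ofReal_re]

end Diagonalization

/-! ### Diagonalization of the coupling matrix by characters -/

section Circulant
variable (N : ℕ) [NeZero N]

/-- The matrix whose columns are the characters of `ℤ / N`. -/
noncomputable def charMatrix : Matrix (ZMod N) (ZMod N) ℂ :=
  Matrix.of fun k j => ZMod.stdAddChar (j * k)

/-- The inverse of `charMatrix N`. -/
noncomputable def charMatrixInv : Matrix (ZMod N) (ZMod N) ℂ :=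
  Matrix.of fun j k => (N : ℂ)⁻¹ * ZMod.stdAddChar (-(j * k))

theorem charMatrixInv_mul : charMatrixInv N * charMatrix N = 1 := by
  ext i j
  have hN : (N : ℂ) ≠ 0 := Nat.cast_ne_zero.2 (NeZero.ne N)
  have h : ∀ k : ZMod N, charMatrixInv N i k * charMatrix N k j =
      (N : ℂ)⁻¹ * ZMod.stdAddChar (k * (j - i)) := by
    intro k
    rw [charMatrixInv, charMatrix, Matrix.of_apply, Matrix.of_apply, mul_assoc,
      ← AddChar.map_add_eq_mul]
    ring_nf
  rw [Matrix.mul_apply, Finset.sum_congr rfl fun k _ => h k, ← Finset.mul_sum,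
    AddChar.sum_mulShift _ (ZMod.isPrimitive_stdAddChar N), ZMod.card]
  by_cases hij : i = j
  · subst hij
    simp [hN]
  · rw [if_neg (sub_ne_zero.2 (Ne.symm hij)), Matrix.one_apply_ne hij]
    simp

theorem charMatrix_mul : charMatrix N * charMatrixInv N = 1 :=
  mul_eq_one_comm.1 (charMatrixInv_mul N)

/-- The eigenvalue of the coupling matrix with `a₀ = -a₂` at the character `k ↦ e^{2πijk/N}`. -/
noncomputable def couplingEigenvalue (a₁ a₂ : ℝ) (j : ZMod N) : ℂ :=
  a₁ + 2 * Complex.I * a₂ * (Real.sin (2 * Real.pi * (j.val : ℝ) / N) : ℂ)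

theorem couplingMatrix_mul_charMatrix (a₁ a₂ : ℝ) :
    (couplingMatrix N (-a₂) a₁ a₂).map (fun x : ℝ => (x : ℂ)) * charMatrix N =
      charMatrix N * Matrix.diagonal (couplingEigenvalue N a₁ a₂) := by
  ext k j
  rw [Matrix.mul_diagonal, Matrix.mul_apply]
  have h : ∀ m : ZMod N, (couplingMatrix N (-a₂) a₁ a₂).map (fun x : ℝ => (x : ℂ)) k m *
      charMatrix N m j = (if m = k then (a₁ : ℂ) * charMatrix N m j else 0) +
        (if m = k + 1 then (a₂ : ℂ) * charMatrix N m j else 0) +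
        (if m = k - 1 then -(a₂ : ℂ) * charMatrix N m j else 0) := by
    intro m
    simp only [couplingMatrix, Matrix.map_apply, Matrix.of_apply, Complex.ofReal_add, add_mul]
    split_ifs <;> simp
  rw [Finset.sum_congr rfl fun m _ => h m, Finset.sum_add_distrib, Finset.sum_add_distrib]
  simp only [Finset.sum_ite_eq', Finset.mem_univ, if_true, charMatrix, Matrix.of_apply]
  rw [mul_add, mul_sub, mul_one, AddChar.map_add_eq_mul, AddChar.map_sub_eq_div]
  have hj : ZMod.stdAddChar j =
      Complex.exp ((2 * Real.pi * (j.val : ℝ) / N : ℝ) * Complex.I) := by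
    rw [ZMod.stdAddChar_apply, ZMod.toCircle_apply]
    congr 1
    push_cast
    ring
  have hs : ∀ x : ℝ, Complex.exp (x * Complex.I) - (Complex.exp (x * Complex.I))⁻¹ =
      2 * Complex.I * (Real.sin x : ℂ) := by
    intro x
    have h2 := Complex.two_sin x
    rw [neg_mul, Complex.exp_neg] at h2
    rw [Complex.ofReal_sin]
    linear_combination -Complex.I * h2 +
      (Complex.exp (x * Complex.I) - (Complex.exp (x * Complex.I))⁻¹) * Complex.I_sq
  rw [couplingEigenvalue, hj, div_eq_mul_inv (ZMod.stdAddChar (j * k) : ℂ)]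
  specialize hs (2 * Real.pi * (j.val : ℝ) / N)
  generalize 2 * Real.pi * (j.val : ℝ) / N = x at hs ⊢
  linear_combination (ZMod.stdAddChar (j * k) : ℂ) * a₂ * hs

theorem spectrum_couplingMatrix (a₁ a₂ : ℝ) :
    spectrum ℂ ((couplingMatrix N (-a₂) a₁ a₂).map (fun x : ℝ => (x : ℂ))) =
      Set.range (couplingEigenvalue N a₁ a₂) := by
  have h : (couplingMatrix N (-a₂) a₁ a₂).map (fun x : ℝ => (x : ℂ)) =
      charMatrix N * Matrix.diagonal (couplingEigenvalue N a₁ a₂) * charMatrixInv N := by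
    rw [← couplingMatrix_mul_charMatrix, Matrix.mul_assoc, charMatrix_mul, Matrix.mul_one]
  rw [h]
  have := spectrum.units_conjugate (R := ℂ) (a := Matrix.diagonal (couplingEigenvalue N a₁ a₂))
    (u := ⟨charMatrix N, charMatrixInv N, charMatrix_mul N, charMatrixInv_mul N⟩)
  exact this.trans (spectrum_diagonal _)

variable {N} in
theorem mem_stableRegion_iff {α : ℝ} (hα₀ : 0 < α) (hα₁ : α < 1) {p : ℝ × ℝ} :
    p ∈ stableRegion α N ↔ ∀ k : ℕ, k < N →
      multiplier (Real.sin (2 * Real.pi * k / N)) p ∈ innerRegion α := by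
  have h1 : p ∈ stableRegion α N ↔ ∀ j : ZMod N,
      multiplier (Real.sin (2 * Real.pi * (j.val : ℝ) / N)) p ∈ innerRegion α := by
    refine (asymptoticallyStable_iff (charMatrix_mul N) (charMatrixInv_mul N)
      (couplingMatrix_mul_charMatrix N p.1 p.2)).trans (forall_congr' fun j => ?_)
    rw [tendsto_scalarSol_iff hα₀ hα₁, ← Set.mem_compl_iff, compl_rootSet hα₀ hα₁]
    have : couplingEigenvalue N p.1 p.2 j - 1 =
        multiplier (Real.sin (2 * Real.pi * (j.val : ℝ) / N)) p := by
      apply Complex.ext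
      · simp [couplingEigenvalue, multiplier, -Complex.ofReal_sin]
      · simp [couplingEigenvalue, multiplier, -Complex.ofReal_sin]
        ring
    rw [this]
  rw [h1]
  constructor
  · intro h k hk
    have := h (k : ZMod N)
    rwa [ZMod.val_cast_of_lt hk] at this
  · intro h j
    exact h j.val (ZMod.val_lt j)

end Circulant

/-! ### The innermost cardioid -/

/-- `|4k - N|` measures the distance of the angle `2πk/N` from `π/2`. -/
theorem sin_eq_cos_abs {N : ℕ} (hN : 0 < N) (k : ℕ) :
    Real.sin (2 * Real.pi * k / N) =
      Real.cos (Real.pi * ((|4 * (k : ℤ) - N| : ℤ) : ℝ) / (2 * N)) := by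
  have hN' : (N : ℝ) ≠ 0 := by positivity
  have h : Real.pi * ((|4 * (k : ℤ) - N| : ℤ) : ℝ) / (2 * N) =
      |2 * Real.pi * k / N - Real.pi / 2| := by
    push_cast
    rw [show 2 * Real.pi * k / N - Real.pi / 2 = Real.pi / (2 * N) * (4 * k - N) by
      field_simp
      ring, abs_mul, abs_of_nonneg (by positivity : 0 ≤ Real.pi / (2 * N))]
    ring
  rw [h, Real.cos_abs, Real.cos_sub_pi_div_two]

theorem abs_sin_le {N j : ℕ} (hmin : ∀ k : ℕ, |4 * (j : ℤ) - N| ≤ |4 * (k : ℤ) - N|) {k : ℕ}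
    (hk : k < N) : |Real.sin (2 * Real.pi * k / N)| ≤ Real.sin (2 * Real.pi * j / N) := by
  have hN : 0 < N := by omega
  have hN' : (0 : ℝ) < N := by exact_mod_cast hN
  have key : ∀ k : ℕ, 2 * k ≤ N →
      |Real.sin (2 * Real.pi * k / N)| ≤ Real.sin (2 * Real.pi * j / N) := by
    intro k hk
    have hkN : |4 * (k : ℤ) - N| ≤ N := abs_le.2 ⟨by omega, by omega⟩
    have hkN' : ((|4 * (k : ℤ) - N| : ℤ) : ℝ) ≤ N := by exact_mod_cast hkN
    have hk0 : (0 : ℝ) ≤ ((|4 * (k : ℤ) - N| : ℤ) : ℝ) := by exact_mod_cast abs_nonneg _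
    have hj0 : (0 : ℝ) ≤ ((|4 * (j : ℤ) - N| : ℤ) : ℝ) := by exact_mod_cast abs_nonneg _
    have hjk : ((|4 * (j : ℤ) - N| : ℤ) : ℝ) ≤ ((|4 * (k : ℤ) - N| : ℤ) : ℝ) := by
      exact_mod_cast hmin k
    have hle : Real.pi * ((|4 * (k : ℤ) - N| : ℤ) : ℝ) / (2 * N) ≤ Real.pi / 2 := by
      rw [div_le_div_iff₀ (by positivity) two_pos]
      nlinarith [Real.pi_pos]
    rw [sin_eq_cos_abs hN, sin_eq_cos_abs hN, abs_of_nonneg]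
    · refine Real.cos_le_cos_of_nonneg_of_le_pi (by positivity) (by linarith [Real.pi_pos]) ?_
      gcongr
    · refine Real.cos_nonneg_of_mem_Icc ⟨?_, hle⟩
      have : 0 ≤ Real.pi * ((|4 * (k : ℤ) - N| : ℤ) : ℝ) / (2 * N) := by positivity
      linarith [Real.pi_pos]
  rcases le_total (2 * k) N with h | h
  · exact key k h
  · have h1 := key (N - k) (by omega)
    rw [Nat.cast_sub hk.le, show 2 * Real.pi * ((N : ℝ) - k) / N =
      2 * Real.pi - 2 * Real.pi * k / N by field_simp, Real.sin_two_pi_sub, abs_neg] at h1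
    exact h1

theorem sin_pos_of_abs_lt {N j : ℕ} (h : |4 * (j : ℤ) - N| < N) :
    0 < Real.sin (2 * Real.pi * j / N) := by
  have hN : 0 < N := by
    have := (abs_nonneg _).trans_lt h
    omega
  have hN' : (0 : ℝ) < N := by exact_mod_cast hN
  have h' : ((|4 * (j : ℤ) - N| : ℤ) : ℝ) < N := by exact_mod_cast h
  have h0 : (0 : ℝ) ≤ ((|4 * (j : ℤ) - N| : ℤ) : ℝ) := by exact_mod_cast abs_nonneg _
  rw [sin_eq_cos_abs hN]
  refine Real.cos_pos_of_mem_Ioo ⟨?_, ?_⟩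
  · have : 0 ≤ Real.pi * ((|4 * (j : ℤ) - N| : ℤ) : ℝ) / (2 * N) := by positivity
    linarith [Real.pi_pos]
  · rw [div_lt_div_iff₀ (by positivity) two_pos]
    nlinarith [Real.pi_pos]

/-- The index for which `2πj/N` is closest to `π/2` gives the innermost cardioid, which decides
the stability. -/
theorem stableRegion_eq {α : ℝ} (hα₀ : 0 < α) (hα₁ : α < 1) {N : ℕ} [NeZero N] {j : ℕ}
    (hmin : ∀ k : ℕ, |4 * (j : ℤ) - N| ≤ |4 * (k : ℤ) - N|) (hlt : |4 * (j : ℤ) - N| < N)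
    (hj2 : j ≤ N / 2) :
    IsInnermost α N j ∧
      stableRegion α N = cardioidInterior α N j ∩ {p : ℝ × ℝ | p.1 < 1} := by
  have hN : 0 < N := NeZero.pos N
  have hpos := sin_pos_of_abs_lt hlt
  have hj1 : 1 ≤ j := by
    have := abs_lt.1 hlt
    omega
  have hle : ∀ k : ℕ, k < N →
      |Real.sin (2 * Real.pi * k / N)| ≤ |Real.sin (2 * Real.pi * j / N)| := fun k hk =>
    (abs_sin_le hmin hk).trans (le_abs_self _)
  refine ⟨⟨⟨hj1, hj2, hpos.ne'⟩, fun k hk1 hk2 hk0 => ?_⟩, ?_⟩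
  · rw [cardioidInterior_eq hα₀ hα₁ hpos.ne', cardioidInterior_eq hα₀ hα₁ hk0]
    rintro p ⟨hp, hp1⟩
    exact multiplier_mem_innerRegion_of_abs_le hα₀ hα₁ hp1 (hle k (by omega)) hp
  · rw [cardioidInterior_eq hα₀ hα₁ hpos.ne']
    ext p
    rw [mem_stableRegion_iff hα₀ hα₁]
    constructor
    · intro h
      refine ⟨h j (by omega), ?_⟩
      -- The eigenvalue at `k = 0` is the real number `a₁`, which forces `a₁ < 1`.
      have h0 := h 0 hN
      have : multiplier (Real.sin (2 * Real.pi * (0 : ℕ) / N)) p = ((p.1 - 1 : ℝ) : ℂ) := by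
        apply Complex.ext <;> simp [multiplier]
      rw [this, ofReal_mem_innerRegion hα₀ hα₁] at h0
      exact sub_neg.1 h0.2
    · rintro ⟨hp, hp1⟩ k hk
      exact multiplier_mem_innerRegion_of_abs_le hα₀ hα₁ hp1 (hle k hk) hp

theorem stableRegion_of_sin_eq_zero {α : ℝ} (hα₀ : 0 < α) (hα₁ : α < 1) {N : ℕ} [NeZero N]
    (hsin : ∀ k : ℕ, k < N → Real.sin (2 * Real.pi * k / N) = 0) :
    stableRegion α N = {p : ℝ × ℝ | 1 - (2 : ℝ) ^ α < p.1 ∧ p.1 < 1} := by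
  ext p
  have h0 : multiplier 0 p = ((p.1 - 1 : ℝ) : ℂ) := by
    apply Complex.ext <;> simp [multiplier]
  have h1 : p ∈ stableRegion α N ↔ multiplier 0 p ∈ innerRegion α := by
    rw [mem_stableRegion_iff hα₀ hα₁]
    constructor
    · intro h
      simpa using h 0 (NeZero.pos N)
    · intro h k hk
      rwa [hsin k hk]
  rw [h1, h0, ofReal_mem_innerRegion hα₀ hα₁]
  constructor
  · rintro ⟨h, h'⟩
    exact ⟨by linarith, by linarith⟩
  · rintro ⟨h, h'⟩
    exact ⟨by linarith, by linarith⟩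

end FracCML

theorem mainTheorem2 (α : ℝ) (hα₀ : 0 < α) (hα₁ : α < 1) (N : ℕ) [NeZero N] :
    (∀ a₁ a₂ : ℝ,
      spectrum ℂ ((FracCML.couplingMatrix N (-a₂) a₁ a₂).map (fun x : ℝ => (x : ℂ))) =
        {z : ℂ | ∃ j : ℕ, j < N ∧
          z = (a₁ : ℂ) + 2 * Complex.I * (a₂ : ℂ) * (Real.sin (2 * Real.pi * j / N) : ℂ)}) ∧
    ((N = 1 ∨ N = 2) →
      FracCML.stableRegion α N = {p : ℝ × ℝ | 1 - (2 : ℝ) ^ α < p.1 ∧ p.1 < 1}) ∧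
    (3 ≤ N → Odd N →
      FracCML.IsInnermost α N ⌈((N : ℝ) - 1) / 4⌉₊ ∧
      FracCML.stableRegion α N =
        FracCML.cardioidInterior α N ⌈((N : ℝ) - 1) / 4⌉₊ ∩ {p : ℝ × ℝ | p.1 < 1}) ∧
    (4 ≤ N → Even N →
      FracCML.IsInnermost α N ⌊(N : ℝ) / 4⌋₊ ∧
      FracCML.stableRegion α N =
        FracCML.cardioidInterior α N ⌊(N : ℝ) / 4⌋₊ ∩ {p : ℝ × ℝ | p.1 < 1}) := by
  refine ⟨fun a₁ a₂ => ?_, fun hN => ?_, fun hN hodd => ?_, fun hN heven => ?_⟩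
  · rw [FracCML.spectrum_couplingMatrix]
    ext z
    constructor
    · rintro ⟨j, rfl⟩
      exact ⟨j.val, ZMod.val_lt j, rfl⟩
    · rintro ⟨j, hj, rfl⟩
      refine ⟨(j : ZMod N), ?_⟩
      rw [FracCML.couplingEigenvalue, ZMod.val_cast_of_lt hj]
  · refine FracCML.stableRegion_of_sin_eq_zero hα₀ hα₁ fun k hk => ?_
    rcases hN with rfl | rfl
    · obtain rfl : k = 0 := by omega
      simp
    · rw [show 2 * Real.pi * k / ((2 : ℕ) : ℝ) = k * Real.pi by
        push_cast
        ring]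
      exact Real.sin_nat_mul_pi k
  · -- Here `|4j - N| = 1`, the least possible value for odd `N`.
    obtain ⟨q, hq⟩ : ∃ q, N = 4 * q + 1 ∨ N = 4 * q + 3 := by
      obtain ⟨m, rfl⟩ := hodd
      exact ⟨m / 2, by omega⟩
    have hj : |4 * ((⌈((N : ℝ) - 1) / 4⌉₊ : ℕ) : ℤ) - N| = 1 := by
      rcases hq with rfl | rfl
      · have : ⌈(((4 * q + 1 : ℕ) : ℝ) - 1) / 4⌉₊ = q := by
          push_cast
          rw [add_sub_cancel_right, mul_div_cancel_left₀ _ (by norm_num), Nat.ceil_natCast]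
        rw [this]
        push_cast
        ring_nf
        norm_num
      · have : ⌈(((4 * q + 3 : ℕ) : ℝ) - 1) / 4⌉₊ = q + 1 := by
          rw [Nat.ceil_eq_iff (by omega)]
          push_cast
          constructor <;> linarith
        rw [this]
        push_cast
        ring_nf
        norm_num
    generalize ⌈((N : ℝ) - 1) / 4⌉₊ = j at hj ⊢
    have hj' := abs_eq (zero_le_one (α := ℤ)) |>.1 hj
    refine FracCML.stableRegion_eq hα₀ hα₁ (fun k => ?_) (by omega) (by omega)
    rw [hj]
    exact Int.one_le_abs (by omega)
  · -- Here `|4j - N|` is `0` or `2` according to the residue of `N` modulo `4`.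
    have hfloor : ⌊(N : ℝ) / 4⌋₊ = N / 4 := by
      simpa using Nat.floor_div_eq_div (K := ℝ) N 4
    rw [hfloor]
    obtain ⟨m, rfl⟩ := heven
    have habs : ∀ x y : ℤ, (x ≤ y ∨ x ≤ -y) → (-x ≤ y ∨ -x ≤ -y) → |x| ≤ |y| := fun x y h h' =>
      abs_le'.2 ⟨le_abs.2 h, le_abs.2 h'⟩
    refine FracCML.stableRegion_eq hα₀ hα₁ (fun k => habs _ _ (by omega) (by omega))
      (abs_lt.2 ⟨by omega, by omega⟩) (by omega)
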